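/- Let $\Sigma$ be a finite alphabet. A \emph{$\circ$-word} over a set $X$ is an isomorphism class of countable linear orders whose positions are labelled by elements of $X$ (isomorphisms are bijections of positions preserving the order and the labels); $X^\circ$ denotes the set of $\circ$-words over $X$. \emph{Free multiplication} $(X^\circ)^\circ\to X^\circ$ replaces each position by the $\circ$-word in its label (lexicographic product). A \emph{$\circ$-semigroup} is a set $S$ with a function $\mu:S^\circ\to S$ such that $\mu$ maps the one-letter $\circ$-word $a$ to $a$ for every $a\in S$, and $\mu(\text{free multiplication of }w)=\mu(\mu^\circ(w))$ for every $w\in(S^\circ)^\circ$, where $f^\circ$ denotes the application of $f$ to every label; for example, $\Sigma^\circ$ with free multiplication is a $\circ$-semigroup. A \emph{homomorphism} $h:S\to T$ of $\circ$-semigroups is a function with $h(\mu_S(w))=\mu_T(h^\circ(w))$ for every $w\in S^\circ$. A language $L\subseteq\Sigma^\circ$ is \emph{recognised} by a $\circ$-semigroup $S$ if there is a homomorphism $h:\Sigma^\circ\to S$ such that $h(w)=h(w')$ implies $w\in L\iff w'\in L$, for all $w,w'\in\Sigma^\circ$. It is \emph{MSO-definable} if there is a sentence $\varphi$ of monadic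 second-order logic (quantification over positions and over sets of positions, Boolean connectives, equality, membership), over the vocabulary consisting of the order $x\le y$ and the unary predicates $a(x)$ for $a\in\Sigma$ (``position $x$ has label $a$''), such that a $\circ$-word $w\in\Sigma^\circ$ belongs to $L$ if and only if $\varphi$ is true in $w$. \textbf{Theorem.} Every language $L\subseteq\Sigma^\circ$ that is recognised by a finite $\circ$-semigroup is MSO-definable. This holds both if the empty linear order is admitted as a $\circ$-word (in every alphabet) and if it is excluded (in every alphabet). -/

import Mathlib

universe u v

namespace CircWord

/-- A countable `A`-labelled linear order. The proposition `E` fixes the convention about the empty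
order: it is admitted if `E` is true, and excluded if `E` is false. -/
structure LabelledOrder (E : Prop) (A : Type u) : Type (max 1 u) where
  Pos : Type
  [order : LinearOrder Pos]
  [countable : Countable Pos]
  nonempty : E ∨ Nonempty Pos
  label : Pos → A

attribute [instance] LabelledOrder.order LabelledOrder.countable

namespace LabelledOrder

variable {E : Prop} {A : Type u} {B : Type v}

/-- Isomorphisms of labelled linear orders: bijections that preserve the order and the labels. -/
structure Iso (w w' : LabelledOrder E A) where
  toOrderIso : w.Pos ≃o w'.Pos
  label_eq : ∀ x, w'.label (toOrderIso x) = w.label x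

def Iso.refl (w : LabelledOrder E A) : Iso w w := ⟨OrderIso.refl _, fun _ => rfl⟩

def Iso.symm {w w' : LabelledOrder E A} (f : Iso w w') : Iso w' w :=
  ⟨f.toOrderIso.symm, fun x => by rw [← f.label_eq, OrderIso.apply_symm_apply]⟩

def Iso.trans {w w' w'' : LabelledOrder E A} (f : Iso w w') (g : Iso w' w'') : Iso w w'' :=
  ⟨f.toOrderIso.trans g.toOrderIso, fun x => by
    rw [OrderIso.trans_apply, g.label_eq, f.label_eq]⟩

instance setoid (E : Prop) (A : Type u) : Setoid (LabelledOrder E A) where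
  r w w' := Nonempty (Iso w w')
  iseqv := ⟨fun w => ⟨Iso.refl w⟩, fun ⟨f⟩ => ⟨f.symm⟩, fun ⟨f⟩ ⟨g⟩ => ⟨f.trans g⟩⟩

/-- Relabelling. -/
def map (f : A → B) (w : LabelledOrder E A) : LabelledOrder E B where
  Pos := w.Pos
  nonempty := w.nonempty
  label := f ∘ w.label

theorem map_congr (f : A → B) {w w' : LabelledOrder E A} (h : w ≈ w') : w.map f ≈ w'.map f := by
  obtain ⟨g⟩ := h
  exact ⟨⟨g.toOrderIso, fun x => congrArg f (g.label_eq x)⟩⟩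

/-- The labelled order with exactly one position. -/
def single (a : A) : LabelledOrder E A where
  Pos := Unit
  nonempty := Or.inr ⟨()⟩
  label _ := a

/-- The lexicographic product: every position `i` of `w` is replaced by the labelled order that is
its label. The positions are the pairs `(i, j)` with `j` a position of `w.label i`. -/
def lexProd (w : LabelledOrder E (LabelledOrder E A)) : LabelledOrder E A where
  Pos := Lex (Σ i : w.Pos, (w.label i).Pos)
  countable := inferInstanceAs (Countable (Σ i : w.Pos, (w.label i).Pos))
  nonempty := by
    rcases w.nonempty with h | ⟨⟨i⟩⟩
    · exact Or.inl h
    · rcases (w.label i).nonempty with h | ⟨⟨j⟩⟩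
      · exact Or.inl h
      · exact Or.inr ⟨toLex ⟨i, j⟩⟩
  label p := (w.label (ofLex p).1).label (ofLex p).2

theorem lexProd_congr {w w' : LabelledOrder E (LabelledOrder E A)} (f : w.Pos ≃o w'.Pos)
    (g : ∀ i, w.label i ≈ w'.label (f i)) : w.lexProd ≈ w'.lexProd := by
  have g' : ∀ i, Iso (w.label i) (w'.label (f i)) := fun i => (g i).some
  let e : (Σ i : w.Pos, (w.label i).Pos) ≃ (Σ i : w'.Pos, (w'.label i).Pos) :=
    Equiv.sigmaCongr f.toEquiv (fun i => (g' i).toOrderIso.toEquiv)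
  let F : w.lexProd.Pos → w'.lexProd.Pos := fun p => toLex (e (ofLex p))
  have hmono : StrictMono F := by
    rintro ⟨i, x⟩ ⟨j, y⟩ h
    rcases Sigma.Lex.lt_def.1 h with h | ⟨h, h'⟩
    · exact Sigma.Lex.lt_def.2 (Or.inl (f.lt_iff_lt.2 h))
    · dsimp at h
      subst h
      exact Sigma.Lex.lt_def.2 (Or.inr ⟨rfl, (g' i).toOrderIso.lt_iff_lt.2 h'⟩)
  have hsurj : Function.Surjective F := fun q =>
    ⟨toLex (e.symm (ofLex q)), congrArg toLex (e.apply_symm_apply (ofLex q))⟩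
  exact ⟨⟨hmono.orderIsoOfSurjective _ hsurj, fun p => (g' (ofLex p).1).label_eq (ofLex p).2⟩⟩

end LabelledOrder

/-- The `∘`-words over `A`: isomorphism classes of countable `A`-labelled linear orders. Every
countable linear order is isomorphic to one in `Type`, so that no isomorphism type is lost. -/
def Word (E : Prop) (A : Type u) : Type (max 1 u) := Quotient (LabelledOrder.setoid E A)

namespace Word

variable {E : Prop} {A : Type u} {B : Type v}

/-- The isomorphism class of a labelled order. -/
def mk (w : LabelledOrder E A) : Word E A := Quotient.mk _ w

/-- A representative of a word. -/
noncomputable def out (w : Word E A) : LabelledOrder E A := Quotient.out w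

theorem mk_out (w : Word E A) : mk (out w) = w := Quotient.out_eq w

/-- The lifting of a function on letters to words. -/
def map (f : A → B) : Word E A → Word E B :=
  Quotient.map (LabelledOrder.map f) (fun _ _ h => LabelledOrder.map_congr f h)

/-- A letter viewed as a one-letter word. -/
def unit (a : A) : Word E A := mk (LabelledOrder.single a)

/-- Free multiplication: each position is replaced by the word in its label. It is computed on
representatives; the result does not depend on them. -/
noncomputable def flatten : Word E (Word E A) → Word E A :=
  Quotient.lift (fun w => mk (w.map out).lexProd) (by
    rintro w w' ⟨f⟩
    refine Quotient.sound (LabelledOrder.lexProd_congr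
      (w := w.map out) (w' := w'.map out) f.toOrderIso fun i => Quotient.exact ?_)
    exact congrArg (fun a => mk (out a)) (f.label_eq i).symm)

theorem flatten_mk (w : LabelledOrder E (LabelledOrder E A)) :
    flatten (mk (w.map mk)) = mk w.lexProd :=
  Quotient.sound (LabelledOrder.lexProd_congr (OrderIso.refl _) fun i =>
    Quotient.mk_out (w.label i))

theorem exists_rep (w : Word E (Word E A)) :
    ∃ w' : LabelledOrder E (LabelledOrder E A), w = mk (w'.map mk) := by
  induction w using Quotient.inductionOn with
  | h w =>
    refine ⟨w.map out, congrArg mk ?_⟩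
    change w = { w with label := fun x => mk (out (w.label x)) }
    simp only [mk_out]

theorem flatten_unit (w : Word E A) : flatten (unit w) = w := by
  induction w using Quotient.inductionOn with
  | h w =>
    refine (flatten_mk (LabelledOrder.single w)).trans (Quotient.sound ⟨LabelledOrder.Iso.symm ?_⟩)
    let F : w.Pos → (LabelledOrder.single (E := E) w).lexProd.Pos := fun x => toLex ⟨(), x⟩
    have hmono : StrictMono F := fun x y h => Sigma.Lex.lt_def.2 (Or.inr ⟨rfl, h⟩)
    exact ⟨hmono.orderIsoOfSurjective _ (fun p => ⟨(ofLex p).2, rfl⟩), fun _ => rfl⟩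

theorem flatten_flatten (w : Word E (Word E (Word E A))) :
    flatten (flatten w) = flatten (map flatten w) := by
  have hrep : ∃ w' : LabelledOrder E (LabelledOrder E (LabelledOrder E A)),
      w = mk (w'.map fun x => mk (x.map mk)) := by
    induction w using Quotient.inductionOn with
    | h w =>
      choose g hg using fun x : Word E (Word E A) => exists_rep x
      refine ⟨w.map g, congrArg mk ?_⟩
      change w = { w with label := fun x => mk ((g (w.label x)).map mk) }
      simp only [← hg]
  obtain ⟨w, rfl⟩ := hrep
  have h₁ : flatten (mk (w.map fun x => mk (x.map mk))) = mk (w.lexProd.map mk) :=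
    flatten_mk (w.map fun x => x.map mk)
  have h₂ : map flatten (mk (w.map fun x => mk (x.map mk)))
      = mk ((w.map LabelledOrder.lexProd).map mk) := by
    change mk { w with label := fun x => flatten (mk ((w.label x).map mk)) } = _
    simp only [flatten_mk]
    rfl
  rw [h₁, h₂, flatten_mk, flatten_mk]
  let F : w.lexProd.lexProd.Pos → (w.map LabelledOrder.lexProd).lexProd.Pos :=
    fun p => toLex ⟨(ofLex (ofLex p).1).1, toLex ⟨(ofLex (ofLex p).1).2, (ofLex p).2⟩⟩
  have hmono : StrictMono F := by
    rintro ⟨⟨i, j⟩, k⟩ ⟨⟨i', j'⟩, k'⟩ h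
    rcases Sigma.Lex.lt_def.1 h with h | ⟨h, h'⟩
    · rcases Sigma.Lex.lt_def.1 h with h | ⟨h, h'⟩
      · exact Sigma.Lex.lt_def.2 (Or.inl h)
      · dsimp at h
        subst h
        exact Sigma.Lex.lt_def.2 (Or.inr ⟨rfl, Sigma.Lex.lt_def.2 (Or.inl h')⟩)
    · cases h
      exact Sigma.Lex.lt_def.2 (Or.inr ⟨rfl, Sigma.Lex.lt_def.2 (Or.inr ⟨rfl, h'⟩)⟩)
  have hsurj : Function.Surjective F := by
    rintro ⟨i, ⟨j, k⟩⟩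
    exact ⟨toLex ⟨toLex ⟨i, j⟩, k⟩, rfl⟩
  exact Quotient.sound ⟨⟨hmono.orderIsoOfSurjective _ hsurj, fun _ => rfl⟩⟩

end Word

/-- A `∘`-semigroup with underlying set `S`. -/
structure CircSemigroup (E : Prop) (S : Type u) where
  mul : Word E S → S
  mul_unit : ∀ a, mul (Word.unit a) = a
  mul_flatten : ∀ w : Word E (Word E S), mul (Word.flatten w) = mul (Word.map mul w)

/-- The free `∘`-semigroup over the alphabet `A`. -/
noncomputable def free (E : Prop) (A : Type u) : CircSemigroup E (Word E A) where
  mul := Word.flatten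
  mul_unit := Word.flatten_unit
  mul_flatten := Word.flatten_flatten

/-- Homomorphisms of `∘`-semigroups. -/
def IsHom {E : Prop} {S : Type u} {T : Type v} (M : CircSemigroup E S) (N : CircSemigroup E T)
    (h : S → T) : Prop :=
  ∀ w : Word E S, h (M.mul w) = N.mul (Word.map h w)

/-- The language `L` is recognised by the `∘`-semigroup `M`. -/
def RecognisedBy {E : Prop} {A : Type u} {S : Type v} (L : Set (Word E A))
    (M : CircSemigroup E S) : Prop :=
  ∃ h : Word E A → S, IsHom (free E A) M h ∧ ∀ w w', h w = h w' → (w ∈ L ↔ w' ∈ L)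

/-- Formulas of monadic second-order logic over the vocabulary of the ordered model
(the binary relation `≤` and a unary relation for every letter), with free position variables
indexed by `Fin n` and free set variables indexed by `Fin m`. A quantifier binds the variable with
index `0` and shifts the indices of the other variables of the same kind by one. -/
inductive MSO (A : Type u) : ℕ → ℕ → Type u
  | le {n m : ℕ} (x y : Fin n) : MSO A n m
  | letter {n m : ℕ} (a : A) (x : Fin n) : MSO A n m
  | eq {n m : ℕ} (x y : Fin n) : MSO A n m
  | mem {n m : ℕ} (x : Fin n) (X : Fin m) : MSO A n m
  | not {n m : ℕ} (φ : MSO A n m) : MSO A n m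
  | and {n m : ℕ} (φ ψ : MSO A n m) : MSO A n m
  | or {n m : ℕ} (φ ψ : MSO A n m) : MSO A n m
  | allPos {n m : ℕ} (φ : MSO A (n + 1) m) : MSO A n m
  | exPos {n m : ℕ} (φ : MSO A (n + 1) m) : MSO A n m
  | allSet {n m : ℕ} (φ : MSO A n (m + 1)) : MSO A n m
  | exSet {n m : ℕ} (φ : MSO A n (m + 1)) : MSO A n m

/-- Satisfaction in the ordered model of `w`, under a valuation of the free variables. -/
def MSO.Realize {E : Prop} {A : Type u} (w : LabelledOrder E A) :
    {n m : ℕ} → MSO A n m → (Fin n → w.Pos) → (Fin m → Set w.Pos) → Prop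
  | _, _, .le x y, ρ, _ => ρ x ≤ ρ y
  | _, _, .letter a x, ρ, _ => w.label (ρ x) = a
  | _, _, .eq x y, ρ, _ => ρ x = ρ y
  | _, _, .mem x X, ρ, σ => ρ x ∈ σ X
  | _, _, .not φ, ρ, σ => ¬ φ.Realize w ρ σ
  | _, _, .and φ ψ, ρ, σ => φ.Realize w ρ σ ∧ ψ.Realize w ρ σ
  | _, _, .or φ ψ, ρ, σ => φ.Realize w ρ σ ∨ ψ.Realize w ρ σ
  | _, _, .allPos φ, ρ, σ => ∀ x : w.Pos, φ.Realize w (Fin.cons x ρ) σ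
  | _, _, .exPos φ, ρ, σ => ∃ x : w.Pos, φ.Realize w (Fin.cons x ρ) σ
  | _, _, .allSet φ, ρ, σ => ∀ X : Set w.Pos, φ.Realize w ρ (Fin.cons X σ)
  | _, _, .exSet φ, ρ, σ => ∃ X : Set w.Pos, φ.Realize w ρ (Fin.cons X σ)

/-- A sentence is a formula without free variables. -/
abbrev Sentence (A : Type u) := MSO A 0 0

/-- The ordered model of `w` satisfies the sentence `φ`. -/
def Satisfies {E : Prop} {A : Type u} (w : LabelledOrder E A) (φ : Sentence A) : Prop :=
  φ.Realize w Fin.elim0 Fin.elim0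

/-- The language `L` is definable in monadic second-order logic. -/
def MSODefinable {E : Prop} {A : Type u} (L : Set (Word E A)) : Prop :=
  ∃ φ : Sentence A, ∀ w : LabelledOrder E A, Word.mk w ∈ L ↔ Satisfies w φ

end CircWord

/-! Let `h` be the recognising homomorphism, so that `h` of a word is the product of the values of
its letters. For each element of the finite `∘`-semigroup it has to be said in MSO that this
product, over all positions, is that element. The sentence guesses a colouring of the positions and
reads values of intervals off it through a definable relation `R`. It has to be shown that a correct
guess exists and that a guess can be verified.

Verification. The sentence checks that `R` contains the letters and is closed under binary products,
`ω`-powers, `ω*`-powers and shuffles (`IsClosedRel`). Each of these is an MSO condition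
(`dfn_isClosedRel`). By `IsClosedRel.ok` such a relation contains the true value of every nonempty
interval. Otherwise, condense the order by identifying points between which all intervals are good.
Classes are good by Ramsey's theorem. Adjacent classes would merge, so the quotient is dense. Some
interval of a dense, finitely coloured order is a shuffle, so closure under shuffles makes different
classes equivalent, a contradiction. Hence if `s` is the only candidate that `R` allows for the
whole word, `s` is its value.

Existence. `evalDefinable` constructs, by downward induction on a lower bound `k` for ranks (sizes
of two-sided ideals), a definable `R` and for each word a colouring making `R` exact on intervals.
Choose a maximal set `X` of points with all factors between them of rank `k`. The value between two
points of `X` can be computed from one finite label at each (`exists_label_of_rank_eq`, by stability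
of finite monoids). Each gap of `X` splits into two parts whose factors have rank above `k`
(`exists_maximal_of_le_rank`), where induction applies. The pieces are multiplied together by
`StepRel`.

The identity of `WithOne` serves as the value of the empty set of positions. All products are
products of nonempty words, so both conventions about the empty order are treated alike; the empty
word itself is added by a separate clause at the end. -/

namespace CircWord

/-! ### Shuffles -/

/-- The colouring `c` of a linear order is a shuffle of the colours in `P`: the order has no
endpoints, and every colour of `P`, and no other one, occurs between any two points. -/
structure IsShuffle {Q : Type*} [LinearOrder Q] {κ : Type*} (c : Q → κ) (P : Set κ) : Prop where
  mem : ∀ q, c q ∈ P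
  exists_lt : ∀ x : Q, ∃ y, y < x
  exists_gt : ∀ x : Q, ∃ y, x < y
  exists_between : ∀ x y : Q, x < y → ∀ p ∈ P, ∃ z, x < z ∧ z < y ∧ c z = p

namespace IsShuffle

variable {α β κ : Type*} [LinearOrder α] [LinearOrder β] {c : α → κ} {d : β → κ} {P : Set κ}

/-- Since `lo` or `hi` may be empty, two auxiliary points are first placed between them; the colour
`p` is then found between these two points. -/
theorem exists_between_finsets [Nonempty α] (h : IsShuffle c P) (lo hi : Finset α)
    (hlt : ∀ x ∈ lo, ∀ y ∈ hi, x < y) {p : κ} (hp : p ∈ P) :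
    ∃ m, (∀ x ∈ lo, x < m) ∧ (∀ y ∈ hi, m < y) ∧ c m = p := by
  have : NoMinOrder α := ⟨h.exists_lt⟩
  have : NoMaxOrder α := ⟨h.exists_gt⟩
  have : DenselyOrdered α := ⟨fun x y hxy => by
    obtain ⟨z, h₁, h₂, -⟩ := h.exists_between x y hxy p hp
    exact ⟨z, h₁, h₂⟩⟩
  obtain ⟨m₁, h₁, h₁'⟩ := Order.exists_between_finsets lo hi hlt
  obtain ⟨m₂, h₂, hgt⟩ := Order.exists_between_finsets (insert m₁ lo) hi (by
    intro x hx y hy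
    rcases Finset.mem_insert.1 hx with rfl | hx
    · exact h₁' y hy
    · exact hlt x hx y hy)
  obtain ⟨z, hz₁, hz₂, hz⟩ := h.exists_between m₁ m₂ (h₂ _ (Finset.mem_insert_self _ _)) p hp
  exact ⟨z, fun x hx => (h₁ x hx).trans hz₁, fun y hy => hz₂.trans (hgt y hy), hz⟩

/-- Finite partial isomorphisms of coloured orders. -/
def PartialIso (c : α → κ) (d : β → κ) : Type _ :=
  { f : Finset (α × β) // (∀ p ∈ f, ∀ q ∈ f, cmp p.1 q.1 = cmp p.2 q.2) ∧ ∀ p ∈ f, c p.1 = d p.2 }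

instance : Preorder (PartialIso c d) := inferInstanceAs (Preorder (Subtype _))

/-- The step of the back-and-forth argument: partners of points below `a` precede partners of points
above `a`, and every colour of `P` occurs in between. -/
theorem exists_across [Nonempty β] (h : IsShuffle d P) (f : PartialIso c d) (a : α)
    (ha : c a ∈ P) : ∃ b, (∀ p ∈ f.1, cmp p.1 a = cmp p.2 b) ∧ c a = d b := by
  by_cases hab : ∃ b, (a, b) ∈ f.1
  · obtain ⟨b, hb⟩ := hab
    exact ⟨b, fun p hp => f.2.1 _ hp _ hb, f.2.2 _ hb⟩
  obtain ⟨b, hb₁, hb₂, hb⟩ := h.exists_between_finsets ({p ∈ f.1 | p.1 < a}.image Prod.snd)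
    ({p ∈ f.1 | a < p.1}.image Prod.snd) (by
      intro x hx y hy
      obtain ⟨p, hp, rfl⟩ := Finset.mem_image.1 hx
      obtain ⟨q, hq, rfl⟩ := Finset.mem_image.1 hy
      rw [Finset.mem_filter] at hp hq
      exact (lt_iff_lt_of_cmp_eq_cmp (f.2.1 _ hp.1 _ hq.1)).1 (hp.2.trans hq.2)) ha
  refine ⟨b, fun p hp => ?_, hb.symm⟩
  have hpa : p.1 ≠ a := fun he => hab ⟨p.2, he ▸ hp⟩
  rcases lt_or_gt_of_ne hpa with hl | hr
  · rw [(cmp_eq_lt_iff _ _).2 hl, (cmp_eq_lt_iff _ _).2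
      (hb₁ _ (Finset.mem_image_of_mem _ (Finset.mem_filter.2 ⟨hp, hl⟩)))]
  · rw [(cmp_eq_gt_iff _ _).2 hr, (cmp_eq_gt_iff _ _).2
      (hb₂ _ (Finset.mem_image_of_mem _ (Finset.mem_filter.2 ⟨hp, hr⟩)))]

theorem exists_extension_left [Nonempty β] (hc : ∀ a, c a ∈ P) (h : IsShuffle d P)
    (f : PartialIso c d) (a : α) : ∃ g, f ≤ g ∧ ∃ b, (a, b) ∈ g.1 := by
  classical
  obtain ⟨b, hb, hab⟩ := h.exists_across f a (hc a)
  refine ⟨⟨insert (a, b) f.1, fun p hp q hq => ?_, fun p hp => ?_⟩, Finset.subset_insert _ _, b,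
    Finset.mem_insert_self _ _⟩
  · rw [Finset.mem_insert] at hp hq
    rcases hp with rfl | hp <;> rcases hq with rfl | hq
    · simp only [cmp_self_eq_eq]
    · rw [cmp_eq_cmp_symm]
      exact hb _ hq
    · exact hb _ hp
    · exact f.2.1 _ hp _ hq
  · rcases Finset.mem_insert.1 hp with rfl | hp
    · exact hab
    · exact f.2.2 _ hp

/-- Exchanging the two sides of a partial isomorphism. -/
def PartialIso.swap (f : PartialIso c d) : PartialIso d c :=
  ⟨f.1.map (Equiv.prodComm α β).toEmbedding, by
    simp only [Finset.mem_map_equiv]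
    exact ⟨fun p hp q hq => (f.2.1 _ hp _ hq).symm, fun p hp => (f.2.2 _ hp).symm⟩⟩

theorem PartialIso.mem_swap (f : PartialIso c d) (p : β × α) : p ∈ f.swap.1 ↔ p.swap ∈ f.1 := by
  simp only [PartialIso.swap, Finset.mem_map_equiv]
  rfl

theorem exists_extension_right [Nonempty α] (hd : ∀ b, d b ∈ P) (h : IsShuffle c P)
    (f : PartialIso c d) (b : β) : ∃ g, f ≤ g ∧ ∃ a, (a, b) ∈ g.1 := by
  obtain ⟨g, hg, a, ha⟩ := h.exists_extension_left hd f.swap b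
  refine ⟨g.swap, fun p hp => (g.mem_swap p).2 (hg ((f.mem_swap _).2 hp)), a, ?_⟩
  exact (g.mem_swap _).2 ha

/-- Two countable shuffles of the same set of colours are isomorphic. -/
theorem exists_iso [Countable α] [Countable β] [Nonempty α] [Nonempty β] (hc : IsShuffle c P)
    (hd : IsShuffle d P) : ∃ e : α ≃o β, ∀ x, d (e x) = c x := by
  cases nonempty_encodable α
  cases nonempty_encodable β
  -- Each point of either side gives a cofinal set of partial isomorphisms. There are countably
  -- many, so one ideal meets them all.
  let D : α ⊕ β → Order.Cofinal (PartialIso c d) := Sum.elim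
    (fun a => ⟨{f | ∃ b, (a, b) ∈ f.1}, fun f => by
      obtain ⟨g, hg, hb⟩ := hd.exists_extension_left hc.mem f a
      exact ⟨g, hb, hg⟩⟩)
    (fun b => ⟨{f | ∃ a, (a, b) ∈ f.1}, fun f => by
      obtain ⟨g, hg, hb⟩ := hc.exists_extension_right hd.mem f b
      exact ⟨g, hb, hg⟩⟩)
  let f₀ : PartialIso c d := ⟨∅, by simp, by simp⟩
  let I := Order.idealOfCofinals f₀ D
  have hF : ∀ a, ∃ b, ∃ f ∈ I, (a, b) ∈ f.1 := fun a => by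
    obtain ⟨f, ⟨b, hb⟩, hf⟩ := Order.cofinal_meets_idealOfCofinals f₀ D (Sum.inl a)
    exact ⟨b, f, hf, hb⟩
  have hG : ∀ b, ∃ a, ∃ f ∈ I, (a, b) ∈ f.1 := fun b => by
    obtain ⟨f, ⟨a, ha⟩, hf⟩ := Order.cofinal_meets_idealOfCofinals f₀ D (Sum.inr b)
    exact ⟨a, f, hf, ha⟩
  choose F hF using hF
  choose G hG using hG
  refine ⟨OrderIso.ofCmpEqCmp F G fun a b => ?_, fun a => ?_⟩
  · obtain ⟨f, hf, ha⟩ := hF a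
    obtain ⟨g, hg, hb⟩ := hG b
    obtain ⟨m, _, fm, gm⟩ := I.directed _ hf _ hg
    exact m.2.1 (a, _) (fm ha) (_, b) (gm hb)
  · obtain ⟨f, hf, ha⟩ := hF a
    exact (f.2.2 _ ha).symm

end IsShuffle

/-! ### Values of words -/

namespace CircSemigroup

variable {E : Prop} {S : Type u} (M : CircSemigroup E S)

/-- The value of a labelling of a nonempty countable linear order. -/
def val {α : Type} [LinearOrder α] [Countable α] [Nonempty α] (f : α → S) : S :=
  M.mul (Word.mk { Pos := α, nonempty := Or.inr inferInstance, label := f })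

section

variable {α β : Type} [LinearOrder α] [Countable α] [Nonempty α] [LinearOrder β] [Countable β]
  [Nonempty β]

theorem val_congr {f : α → S} {g : β → S} (e : α ≃o β) (h : ∀ x, g (e x) = f x) :
    M.val f = M.val g :=
  congrArg M.mul (Quotient.sound ⟨⟨e, h⟩⟩)

theorem val_of_unique [Unique α] (f : α → S) : M.val f = f default := by
  refine Eq.trans (congrArg M.mul (Quotient.sound ⟨⟨?_, ?_⟩⟩)) (M.mul_unit (f default))
  · exact OrderIso.ofUnique α Unit
  · intro x
    rw [Unique.eq_default x]
    rfl

/-- The value of a word that is cut into factors is the value of the word of the values of the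
factors. -/
theorem val_fiber (f : α → S) (q : α → β) (hq : Monotone q) (hs : Function.Surjective q) :
    haveI : ∀ b, Nonempty {x // q x = b} := fun b => nonempty_subtype.2 (hs b)
    M.val f = M.val fun b => M.val fun x : {x // q x = b} => f x := by
  have : ∀ b, Nonempty {x // q x = b} := fun b => nonempty_subtype.2 (hs b)
  -- The word is the lexicographic product of its fibres, so the claim becomes `mul_flatten` for
  -- `W`.
  let W : LabelledOrder E (LabelledOrder E S) :=
    { Pos := β
      nonempty := Or.inr inferInstance
      label := fun b =>
        { Pos := {x // q x = b}, nonempty := Or.inr inferInstance, label := fun x => f x } }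
  have h := M.mul_flatten (Word.mk (W.map Word.mk))
  rw [Word.flatten_mk] at h
  refine Eq.trans (congrArg M.mul (Quotient.sound ⟨LabelledOrder.Iso.symm ?_⟩)) h
  let F : W.lexProd.Pos → α := fun p => (ofLex p).2.1
  have hF : StrictMono F := by
    rintro ⟨i, x⟩ ⟨j, y⟩ h
    have hx : q x.1 = i := x.2
    have hy : q y.1 = j := y.2
    rcases Sigma.Lex.lt_def.1 h with h | ⟨h, h'⟩
    · refine lt_of_not_ge fun hle => ?_
      have h' : q y.1 ≤ q x.1 := hq hle
      rw [hx, hy] at h'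
      exact h'.not_gt h
    · dsimp at h
      subst h
      exact h'
  exact ⟨hF.orderIsoOfSurjective _ fun x => ⟨toLex ⟨q x, x, rfl⟩, rfl⟩, fun _ => rfl⟩

end

/-- The underlying set of a `∘`-semigroup, as a semigroup. -/
def Carrier (_ : CircSemigroup E S) : Type u := S

instance [Finite S] : Finite M.Carrier := inferInstanceAs (Finite S)

instance [Finite S] : Finite (WithOne M.Carrier) := inferInstanceAs (Finite (Option M.Carrier))

instance : Mul M.Carrier := ⟨fun a b => M.val fun i : Bool => cond i b a⟩

variable {M}

/-- The value of a word, in the semigroup that underlies `M`. -/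
def eval {α : Type} [LinearOrder α] [Countable α] [Nonempty α] (f : α → M.Carrier) : M.Carrier :=
  M.val f

theorem eval_of_unique {α : Type} [LinearOrder α] [Countable α] [Nonempty α] [Unique α]
    (f : α → M.Carrier) : eval f = f default :=
  M.val_of_unique f

section

variable {α β : Type} [LinearOrder α] [Countable α] [Nonempty α] [LinearOrder β] [Countable β]
  [Nonempty β]

theorem eval_congr {f : α → M.Carrier} {g : β → M.Carrier} (e : α ≃o β)
    (h : ∀ x, g (e x) = f x) : eval f = eval g :=
  M.val_congr e h

theorem eval_fiber (f : α → M.Carrier) (q : α → β) (hq : Monotone q)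
    (hs : Function.Surjective q) :
    haveI : ∀ b, Nonempty {x // q x = b} := fun b => nonempty_subtype.2 (hs b)
    eval f = eval fun b => eval fun x : {x // q x = b} => f x :=
  M.val_fiber f q hq hs

end

/-- The value of the restriction of a word to a set of positions; `1` if the set is empty. -/
noncomputable def value {α : Type} [LinearOrder α] [Countable α] (f : α → M.Carrier)
    (I : Set α) : WithOne M.Carrier :=
  open Classical in
  if h : I.Nonempty then
    haveI := h.to_subtype
    ((eval fun x : I => f x : M.Carrier) : WithOne M.Carrier)
  else 1

section

variable {α : Type} [LinearOrder α] [Countable α] (f : α → M.Carrier)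

@[simp]
theorem value_empty : value f ∅ = 1 := by simp [value]

theorem value_of_nonempty {I : Set α} [h : Nonempty I] :
    value f I = ((eval fun x : I => f x : M.Carrier) : WithOne M.Carrier) := by
  rw [value, dif_pos (Set.nonempty_coe_sort.1 h)]

theorem exists_value_eq_coe {I : Set α} (h : I.Nonempty) : ∃ a : M.Carrier, value f I = a := by
  have := h.to_subtype
  exact ⟨_, value_of_nonempty f⟩

@[simp]
theorem value_singleton (x : α) : value f {x} = f x := by
  rw [value_of_nonempty, eval_of_unique]
  rfl

theorem value_univ [Nonempty α] :
    value f Set.univ = ((eval f : M.Carrier) : WithOne M.Carrier) := by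
  rw [value_of_nonempty]
  exact congrArg _ (eval_congr OrderIso.Set.univ fun _ => rfl)

/-- The value of a subword that is cut into factors. -/
theorem value_eq_eval {Q : Type} [LinearOrder Q] [Countable Q] [Nonempty Q] {I : Set α}
    (q : I → Q) (hq : Monotone q) (hs : Function.Surjective q) (g : Q → M.Carrier)
    (hg : ∀ b, value f {x | ∃ h : x ∈ I, q ⟨x, h⟩ = b} = g b) :
    value f I = ((eval g : M.Carrier) : WithOne M.Carrier) := by
  have : Nonempty I := ⟨(hs (Classical.arbitrary Q)).choose⟩
  have : ∀ b, Nonempty {x // q x = b} := fun b => nonempty_subtype.2 (hs b)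
  rw [value_of_nonempty, eval_fiber _ q hq hs]
  congr 2
  funext b
  obtain ⟨y, hy⟩ := hs b
  have : Nonempty {x | ∃ h : x ∈ I, q ⟨x, h⟩ = b} := ⟨⟨y, y.2, hy⟩⟩
  have h := hg b
  rw [value_of_nonempty] at h
  rw [← WithOne.coe_injective h]
  let e : {x // q x = b} → {x | ∃ h : x ∈ I, q ⟨x, h⟩ = b} := fun x => ⟨x.1.1, x.1.2, x.2⟩
  have he : StrictMono e := fun x y h => h
  exact eval_congr (he.orderIsoOfSurjective e fun x => ⟨⟨⟨x.1, x.2.1⟩, x.2.2⟩, rfl⟩) fun _ => rfl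

theorem value_union_of_nonempty {I J : Set α} (hI : I.Nonempty) (hJ : J.Nonempty)
    (h : ∀ x ∈ I, ∀ y ∈ J, x < y) {a b : M.Carrier} (ha : value f I = a) (hb : value f J = b) :
    value f (I ∪ J) = ((a * b : M.Carrier) : WithOne M.Carrier) := by
  classical
  refine value_eq_eval f (Q := Bool) (fun x => decide (x.1 ∈ J)) ?_ ?_ _ ?_
  · intro x y hxy
    by_cases hx : x.1 ∈ J
    · have hy : y.1 ∈ J := y.2.resolve_left fun hy => (h _ hy _ hx).not_ge hxy
      simp [hx, hy]
    · simp [hx]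
  · rintro (_ | _)
    · obtain ⟨x, hx⟩ := hI
      exact ⟨⟨x, Or.inl hx⟩, by simpa using fun hx' => (h x hx x hx').false⟩
    · obtain ⟨x, hx⟩ := hJ
      exact ⟨⟨x, Or.inr hx⟩, by simpa using hx⟩
  · rintro (_ | _)
    · refine Eq.trans (congrArg (value f) ?_) ha
      ext x
      simp only [Set.mem_union, decide_eq_false_iff_not, exists_prop, Set.mem_ofPred_eq]
      exact ⟨fun hx => hx.1.resolve_right hx.2, fun hx => ⟨Or.inl hx, fun hx' =>
        (h x hx x hx').false⟩⟩
    · refine Eq.trans (congrArg (value f) ?_) hb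
      ext x
      simp only [Set.mem_union, decide_eq_true_eq, exists_prop, Set.mem_ofPred_eq]
      exact ⟨fun hx => hx.2, fun hx => ⟨Or.inr hx, hx⟩⟩

end

/-- Both bracketings are cuttings of the same three-letter word. -/
instance : Semigroup M.Carrier where
  mul_assoc a b c := by
    let f : Fin 3 → M.Carrier := ![a, b, c]
    have h0 : value f {0} = a := value_singleton f 0
    have h1 : value f {1} = b := value_singleton f 1
    have h2 : value f {2} = c := value_singleton f 2
    have h01 := value_union_of_nonempty f (I := {0}) (J := {1}) (by simp) (by simp) (by simp) h0 h1
    have h12 := value_union_of_nonempty f (I := {1}) (J := {2}) (by simp) (by simp) (by simp) h1 h2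
    have h012 := value_union_of_nonempty f (I := {0} ∪ {1}) (J := {2}) (by simp) (by simp) (by simp)
      h01 h2
    have hassoc := value_union_of_nonempty f (I := {0}) (J := {1} ∪ {2}) (by simp) (by simp)
      (by simp) h0 h12
    rw [← Set.union_assoc, h012] at hassoc
    exact WithOne.coe_injective hassoc

/-- The `ω`-power. -/
def omega (a : WithOne M.Carrier) : WithOne M.Carrier :=
  WithOne.recOneCoe 1 (fun a => ((eval fun _ : ℕ => a : M.Carrier) : WithOne M.Carrier)) a

/-- The `ω*`-power. -/
def omegaStar (a : WithOne M.Carrier) : WithOne M.Carrier :=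
  WithOne.recOneCoe 1 (fun a => ((eval fun _ : ℕᵒᵈ => a : M.Carrier) : WithOne M.Carrier)) a

/-- The value of the shuffles of a set `P` of colours under an interpretation of the colours. -/
noncomputable def shuffle {κ : Type v} (g : κ → M.Carrier) (P : Set κ) : WithOne M.Carrier :=
  open Classical in
  -- The choice of colouring does not matter, by `IsShuffle.exists_iso`. The default is irrelevant
  -- whenever `P` is the colour set of a nonempty countable shuffle, since such a shuffle can be
  -- transported to `ℚ`.
  if h : ∃ c : ℚ → κ, IsShuffle c P then
    ((eval fun x => g (h.choose x) : M.Carrier) : WithOne M.Carrier)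
  else 1

section

variable {α : Type} [LinearOrder α] [Countable α] (f : α → M.Carrier)

theorem value_union {I J : Set α} (h : ∀ x ∈ I, ∀ y ∈ J, x < y) :
    value f (I ∪ J) = value f I * value f J := by
  rcases I.eq_empty_or_nonempty with rfl | hI
  · simp
  rcases J.eq_empty_or_nonempty with rfl | hJ
  · simp
  obtain ⟨a, ha⟩ := exists_value_eq_coe f hI
  obtain ⟨b, hb⟩ := exists_value_eq_coe f hJ
  rw [value_union_of_nonempty f hI hJ h ha hb, ha, hb, WithOne.coe_mul]

/-- By Cantor's theorem `Q` is a copy of `ℚ`; uniqueness of shuffles then allows the chosen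
colouring in `shuffle` to replace `c`. -/
theorem value_eq_shuffle {κ : Type v} (g : κ → M.Carrier) (P : Set κ) {Q : Type} [LinearOrder Q]
    [Countable Q] [Nonempty Q] {I : Set α} (q : I → Q) (hq : Monotone q)
    (hs : Function.Surjective q) (c : Q → κ) (hc : IsShuffle c P)
    (hg : ∀ b, value f {x | ∃ h : x ∈ I, q ⟨x, h⟩ = b} = g (c b)) :
    value f I = shuffle g P := by
  have : NoMinOrder Q := ⟨hc.exists_lt⟩
  have : NoMaxOrder Q := ⟨hc.exists_gt⟩
  have : DenselyOrdered Q := ⟨fun x y hxy => by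
    obtain ⟨z, h₁, h₂, -⟩ := hc.exists_between x y hxy _ (hc.mem x)
    exact ⟨z, h₁, h₂⟩⟩
  have h : ∃ c : ℚ → κ, IsShuffle c P := by
    obtain ⟨e⟩ := Order.iso_of_countable_dense Q ℚ
    refine ⟨c ∘ e.symm, fun q => hc.mem _, exists_lt, exists_gt, fun x y hxy p hp => ?_⟩
    obtain ⟨z, h₁, h₂, h₃⟩ := hc.exists_between _ _ (e.symm.lt_iff_lt.2 hxy) p hp
    exact ⟨e z, e.symm_apply_lt.1 h₁, e.lt_symm_apply.1 h₂, by simpa using h₃⟩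
  rw [value_eq_eval f q hq hs _ hg, shuffle, dif_pos h]
  obtain ⟨e, he⟩ := hc.exists_iso h.choose_spec
  exact congrArg _ (eval_congr e fun x => congrArg g (he x))

end

end CircSemigroup

end CircWord

namespace CircWord

/-! ### Sequences and homogeneous sets -/

/-- Enumerate `Z` and let each new term exceed both the previous term and the next element of the
enumeration; this forces cofinality. -/
theorem exists_strictMono_seq {α : Type*} [LinearOrder α] [Countable α] {Z : Set α} {z : α}
    (hz : z ∈ Z) (h : ∀ x ∈ Z, ∃ y ∈ Z, x < y) :
    ∃ u : ℕ → α, StrictMono u ∧ u 0 = z ∧ (∀ n, u n ∈ Z) ∧ ∀ x ∈ Z, ∃ n, x < u n := by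
  have : Nonempty Z := ⟨⟨z, hz⟩⟩
  obtain ⟨e, he⟩ := exists_surjective_nat Z
  have hstep : ∀ x y : Z, ∃ t : Z, x < t ∧ y < t := fun x y => by
    obtain ⟨t, ht, hxt⟩ := h (max x y : Z).1 (max x y).2
    exact ⟨⟨t, ht⟩, (le_max_left x y).trans_lt hxt, (le_max_right x y).trans_lt hxt⟩
  choose next hnext hnext' using hstep
  let u : ℕ → Z := fun n => Nat.rec ⟨z, hz⟩ (fun n x => next x (e n)) n
  refine ⟨fun n => (u n).1, strictMono_nat_of_lt_succ fun n => hnext (u n) (e n), rfl,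
    fun n => (u n).2, fun x hx => ?_⟩
  obtain ⟨n, hn⟩ := he ⟨x, hx⟩
  have hlt : e n < u (n + 1) := hnext' (u n) (e n)
  rw [hn] at hlt
  exact ⟨n + 1, hlt⟩

theorem exists_strictAnti_seq {α : Type*} [LinearOrder α] [Countable α] {Z : Set α} {z : α}
    (hz : z ∈ Z) (h : ∀ x ∈ Z, ∃ y ∈ Z, y < x) :
    ∃ u : ℕ → α, StrictAnti u ∧ u 0 = z ∧ (∀ n, u n ∈ Z) ∧ ∀ x ∈ Z, ∃ n, u n < x := by
  have : Countable αᵒᵈ := ‹Countable α›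
  exact exists_strictMono_seq (α := αᵒᵈ) hz h

/-- Ramsey's theorem for pairs of natural numbers. -/
theorem exists_strictMono_homogeneous {κ : Type*} [Finite κ] (χ : ℕ → ℕ → κ) :
    ∃ (e : κ) (φ : ℕ → ℕ), StrictMono φ ∧ ∀ i j, i < j → χ (φ i) (φ j) = e := by
  -- The ultrafilter gives each `i` a limit colour `c i`, and almost all `i` share one limit colour
  -- `e`. Such points can be picked greedily, because finitely many conditions that hold almost
  -- everywhere hold simultaneously.
  let U := Filter.hyperfilter ℕ
  have hlim : ∀ i, ∃ c, ∀ᶠ j in (U : Filter ℕ), χ i j = c := fun i =>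
    Ultrafilter.eventually_exists_iff.1 (Filter.Eventually.of_forall fun j => ⟨_, rfl⟩)
  choose c hc using hlim
  obtain ⟨e, he⟩ : ∃ e, ∀ᶠ i in (U : Filter ℕ), c i = e :=
    Ultrafilter.eventually_exists_iff.1 (Filter.Eventually.of_forall fun j => ⟨_, rfl⟩)
  have hgt : ∀ i, ∀ᶠ j in (U : Filter ℕ), i < j := fun i =>
    Nat.hyperfilter_le_atTop (Filter.eventually_gt_atTop i)
  obtain ⟨φ, -, hφ⟩ := exists_seq_of_forall_finset_exists (fun i => c i = e)
    (fun i j => i < j ∧ χ i j = e) (fun s hs => by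
      have h₁ : ∀ᶠ j in (U : Filter ℕ), ∀ i ∈ s, i < j ∧ χ i j = e :=
        (Filter.eventually_all_finset s).2 fun i hi => by
          filter_upwards [hgt i, hc i] with j h₁ h₂
          exact ⟨h₁, h₂.trans (hs i hi)⟩
      exact (he.and h₁).exists)
  exact ⟨e, φ, fun i j hij => (hφ i j hij).1, fun i j hij => (hφ i j hij).2⟩

/-! ### Finite monoids -/

/-- The number of elements of the two-sided ideal generated by an element of a monoid. -/
noncomputable def rank {T : Type*} [Monoid T] (a : T) : ℕ := {x | ∃ u v, x = u * a * v}.ncard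

section rank

variable {T : Type*} [Monoid T] [Finite T]

theorem rank_mul_mul_le (u a v : T) : rank (u * a * v) ≤ rank a := by
  refine Set.ncard_le_ncard ?_ (Set.toFinite _)
  rintro _ ⟨x, y, rfl⟩
  exact ⟨x * u, v * y, by simp only [mul_assoc]⟩

theorem rank_mul_le_left (a v : T) : rank (a * v) ≤ rank a := by
  simpa using rank_mul_mul_le 1 a v

theorem rank_mul_le_right (u a : T) : rank (u * a) ≤ rank a := by
  simpa using rank_mul_mul_le u a 1

theorem rank_le_card (a : T) : rank a ≤ Nat.card T := Set.ncard_le_card _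

theorem exists_isIdempotentElem_pow (a : T) : ∃ n, IsIdempotentElem (a ^ (n + 1)) := by
  obtain ⟨m, n, hne, h⟩ := Finite.exists_ne_map_eq_of_infinite (fun n : ℕ => a ^ n)
  wlog hmn : m < n generalizing m n
  · exact this n m hne.symm h.symm (lt_of_le_of_ne (not_lt.1 hmn) hne.symm)
  obtain ⟨p, rfl⟩ := Nat.exists_eq_add_of_lt hmn
  have hper : ∀ k i, m ≤ i → a ^ (i + k * (p + 1)) = a ^ i := by
    intro k
    induction k with
    | zero => simp
    | succ k ih =>
      intro i hi
      obtain ⟨j, rfl⟩ := Nat.exists_eq_add_of_le hi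
      have h' : a ^ (m + j + (p + 1)) = a ^ (m + j) := by
        rw [show m + j + (p + 1) = j + (m + p + 1) by ring, pow_add, ← h, ← pow_add, add_comm]
      rw [show m + j + (k + 1) * (p + 1) = (m + j + (p + 1)) + k * (p + 1) by ring,
        ih _ (by omega), h']
  -- The exponent is `(m + 1) * (p + 1)`, a multiple of the period `p + 1` that lies beyond the
  -- preperiod `m`.
  refine ⟨m * (p + 1) + p, ?_⟩
  rw [IsIdempotentElem, ← pow_add,
    show m * (p + 1) + p + 1 + (m * (p + 1) + p + 1)
      = m * (p + 1) + p + 1 + (m + 1) * (p + 1) by ring, hper]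
  nlinarith

/-- An element that is not sent to a smaller ideal by a left multiplication can be recovered. -/
theorem exists_left_inverse_of_rank_eq {a s : T} (h : rank (a * s) = rank s) :
    ∃ u, s = u * (a * s) := by
  have hsub : {x | ∃ u v, x = u * (a * s) * v} ⊆ {x | ∃ u v, x = u * s * v} := by
    rintro _ ⟨x, y, rfl⟩
    exact ⟨x * a, y, by simp only [mul_assoc]⟩
  have heq := Set.eq_of_subset_of_ncard_le hsub h.ge (Set.toFinite _)
  have hs : s ∈ {x | ∃ u v, x = u * (a * s) * v} := heq ▸ ⟨1, 1, by simp⟩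
  obtain ⟨u, v, huv⟩ := hs
  -- Stability of finite monoids: the equation `s = u * a * s * v` is iterated until the power of `u
  -- * a` is idempotent. That power then fixes `s` under left multiplication, and the right factor
  -- disappears.
  have hpow : ∀ n, s = (u * a) ^ n * s * v ^ n := by
    intro n
    induction n with
    | zero => simp
    | succ n ih =>
      calc s = (u * a) ^ n * s * v ^ n := ih
        _ = (u * a) ^ n * (u * (a * s) * v) * v ^ n := by rw [← huv]
        _ = (u * a) ^ (n + 1) * s * v ^ (n + 1) := by
          rw [pow_succ, pow_succ']
          simp only [mul_assoc]
  obtain ⟨n, hn⟩ := exists_isIdempotentElem_pow (u * a)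
  have h₁ : (u * a) ^ (n + 1) * s = s := by
    conv_lhs => rw [hpow (n + 1), mul_assoc, ← mul_assoc, hn.eq, ← mul_assoc]
    exact (hpow (n + 1)).symm
  refine ⟨(u * a) ^ n * u, ?_⟩
  conv_lhs => rw [← h₁, pow_succ]
  simp only [mul_assoc]

end rank

/-! ### Values of subwords and infinite products -/

/-- The points above `z` that are bounded by a point of `Z`. -/
def upper {α : Type*} [LinearOrder α] (Z : Set α) (z : α) : Set α :=
  {x | z ≤ x ∧ ∃ y ∈ Z, x < y}

/-- The points strictly below `z` that are bounded by a point of `Z`. -/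
def lower {α : Type*} [LinearOrder α] (Z : Set α) (z : α) : Set α :=
  {x | x < z ∧ ∃ y ∈ Z, y ≤ x}

theorem upper_ordConnected {α : Type*} [LinearOrder α] (Z : Set α) (z : α) :
    (upper Z z).OrdConnected :=
  ⟨fun _ hx _ hy _ ht => ⟨hx.1.trans ht.1, by
    obtain ⟨s, hs, hys⟩ := hy.2
    exact ⟨s, hs, ht.2.trans_lt hys⟩⟩⟩

theorem lower_ordConnected {α : Type*} [LinearOrder α] (Z : Set α) (z : α) :
    (lower Z z).OrdConnected :=
  ⟨fun _ hx _ hy _ ht => ⟨ht.2.trans_lt hy.1, by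
    obtain ⟨s, hs, hxs⟩ := hx.2
    exact ⟨s, hs, hxs.trans ht.1⟩⟩⟩

namespace CircSemigroup

variable {E : Prop} {S : Type u} {M : CircSemigroup E S} {α : Type} [LinearOrder α] [Countable α]
  (f : α → M.Carrier)

theorem value_iUnion {Q : Type} [LinearOrder Q] [Countable Q] [Nonempty Q] (J : Q → Set α)
    (hJ : ∀ i j, i < j → ∀ x ∈ J i, ∀ y ∈ J j, x < y) (g : Q → M.Carrier)
    (hg : ∀ i, value f (J i) = g i) :
    value f (⋃ i, J i) = ((eval g : M.Carrier) : WithOne M.Carrier) := by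
  choose q hq using fun x : (⋃ i, J i) => Set.mem_iUnion.1 x.2
  have huniq : ∀ (x : (⋃ i, J i)) i, x.1 ∈ J i → q x = i := fun x i hi => by
    rcases lt_trichotomy (q x) i with h | h | h
    · exact ((hJ _ _ h _ (hq x) _ hi).false).elim
    · exact h
    · exact ((hJ _ _ h _ hi _ (hq x)).false).elim
  refine value_eq_eval f q (fun x y hxy => ?_) (fun i => ?_) g fun i => ?_
  · exact le_of_not_gt fun h => (hJ _ _ h _ (hq y) _ (hq x)).not_ge hxy
  -- An empty factor would have value `1`, which is not an element of the semigroup.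
  · have hne : (J i).Nonempty := by
      by_contra hne
      rw [Set.not_nonempty_iff_eq_empty] at hne
      have := hg i
      rw [hne, value_empty] at this
      exact WithOne.coe_ne_one this.symm
    obtain ⟨x, hx⟩ := hne
    exact ⟨⟨x, Set.mem_iUnion.2 ⟨i, hx⟩⟩, huniq _ _ hx⟩
  · rw [← hg i]
    congr 1
    ext x
    constructor
    · rintro ⟨hx, rfl⟩
      exact hq ⟨x, hx⟩
    · exact fun hx => ⟨Set.mem_iUnion.2 ⟨i, hx⟩, huniq _ _ hx⟩

/-- A cofinal increasing sequence in `Z` that starts at `z` cuts the set into `ω` many factors of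
value `e`. -/
theorem value_upper {Z : Set α} {z : α} (hz : z ∈ Z) (hmax : ∀ x ∈ Z, ∃ y ∈ Z, x < y)
    {e : WithOne M.Carrier} (he : ∀ x ∈ Z, ∀ y ∈ Z, x < y → value f (Set.Ico x y) = e) :
    value f (upper Z z) = omega e := by
  obtain ⟨u, hu, hu0, huZ, hcof⟩ := exists_strictMono_seq hz hmax
  obtain ⟨a, ha⟩ := exists_value_eq_coe f (Set.nonempty_Ico.2 (hu (Nat.lt_succ_self 0)))
  rw [he _ (huZ _) _ (huZ _) (hu (Nat.lt_succ_self 0))] at ha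
  have hUnion : upper Z z = ⋃ n, Set.Ico (u n) (u (n + 1)) := by
    ext x
    simp only [upper, Set.mem_ofPred_eq, Set.mem_iUnion, Set.mem_Ico]
    constructor
    · rintro ⟨hzx, y, hy, hxy⟩
      obtain ⟨n, hn⟩ := hcof y hy
      classical
      have hex : ∃ n, x < u n := ⟨n, hxy.trans hn⟩
      have hpos : Nat.find hex ≠ 0 := fun h0 => by
        have := Nat.find_spec hex
        rw [h0, hu0] at this
        exact this.not_ge hzx
      obtain ⟨k, hk⟩ := Nat.exists_eq_succ_of_ne_zero hpos
      refine ⟨k, not_lt.1 (Nat.find_min hex (by omega)), ?_⟩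
      have := Nat.find_spec hex
      rwa [hk] at this
    · rintro ⟨n, h₁, h₂⟩
      exact ⟨hu0 ▸ (hu.monotone (Nat.zero_le n)).trans h₁, _, huZ _, h₂⟩
  rw [hUnion, value_iUnion f _ _ (fun _ => a) fun n => ?_, ha]
  · rfl
  · intro i j hij x hx y hy
    exact hx.2.trans_le ((hu.monotone (Nat.succ_le_of_lt hij)).trans hy.1)
  · rw [he _ (huZ _) _ (huZ _) (hu (Nat.lt_succ_self n)), ha]

theorem value_lower {Z : Set α} {z : α} (hz : z ∈ Z) (hmin : ∀ x ∈ Z, ∃ y ∈ Z, y < x)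
    {e : WithOne M.Carrier} (he : ∀ x ∈ Z, ∀ y ∈ Z, x < y → value f (Set.Ico x y) = e) :
    value f (lower Z z) = omegaStar e := by
  obtain ⟨u, hu, hu0, huZ, hcof⟩ := exists_strictAnti_seq hz hmin
  obtain ⟨a, ha⟩ := exists_value_eq_coe f (Set.nonempty_Ico.2 (hu (Nat.lt_succ_self 0)))
  rw [he _ (huZ _) _ (huZ _) (hu (Nat.lt_succ_self 0))] at ha
  have hUnion : lower Z z = ⋃ n : ℕᵒᵈ,
      Set.Ico (u (OrderDual.ofDual n + 1)) (u (OrderDual.ofDual n)) := by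
    ext x
    simp only [lower, Set.mem_ofPred_eq, Set.mem_iUnion, Set.mem_Ico, OrderDual.exists,
      OrderDual.ofDual_toDual]
    constructor
    · rintro ⟨hzx, y, hy, hxy⟩
      obtain ⟨n, hn⟩ := hcof y hy
      classical
      have hex : ∃ n, u n ≤ x := ⟨n, hn.le.trans hxy⟩
      have hpos : Nat.find hex ≠ 0 := fun h0 => by
        have := Nat.find_spec hex
        rw [h0, hu0] at this
        exact this.not_gt hzx
      obtain ⟨k, hk⟩ := Nat.exists_eq_succ_of_ne_zero hpos
      refine ⟨k, ?_, not_le.1 (Nat.find_min hex (by omega))⟩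
      have := Nat.find_spec hex
      rwa [hk] at this
    · rintro ⟨n, h₁, h₂⟩
      exact ⟨hu0 ▸ h₂.trans_le (hu.antitone (Nat.zero_le n)), _, huZ _, h₁⟩
  rw [hUnion, value_iUnion f _ _ (fun _ => a) fun n => ?_, ha]
  · rfl
  · intro i j hij x hx y hy
    exact hx.2.trans_le ((hu.antitone (Nat.succ_le_of_lt hij)).trans hy.1)
  · rw [he _ (huZ _) _ (huZ _) (hu (Nat.lt_succ_self _)), ha]

theorem value_Ico_mul {x y z : α} (hxy : x ≤ y) (hyz : y ≤ z) :
    value f (Set.Ico x y) * value f (Set.Ico y z) = value f (Set.Ico x z) := by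
  rw [← Set.Ico_union_Ico_eq_Ico hxy hyz, value_union]
  exact fun s hs t ht => hs.2.trans_le ht.1

end CircSemigroup

end CircWord

namespace CircWord

/-! ### Condensations -/

/-- Convex classes are linearly ordered like any system of representatives. This form lets the
quotient order be treated as the suborder `Set.range ρ`. -/
theorem exists_monotone_rep {α : Type*} [LinearOrder α] {r : α → α → Prop} (hr : Equivalence r)
    (hconv : ∀ x y z, x ≤ y → y ≤ z → r x z → r x y) :
    ∃ ρ : α → α, Monotone ρ ∧ (∀ x, ρ (ρ x) = ρ x) ∧ ∀ x y, r x y ↔ ρ x = ρ y := by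
  let s : Setoid α := ⟨r, hr⟩
  have hout : ∀ x, r (Quotient.mk s x).out x := fun x => Quotient.mk_out (s := s) x
  have hiff : ∀ x y, r x y ↔ (Quotient.mk s x).out = (Quotient.mk s y).out := fun x y => by
    rw [Quotient.out_inj]
    exact (Quotient.eq (r := s)).symm
  refine ⟨fun x => (Quotient.mk s x).out, fun x y hxy => ?_, fun x => (hiff _ _).1 (hout x), hiff⟩
  by_cases h : r x y
  · exact ((hiff x y).1 h).le
  refine le_of_not_gt fun hlt => h ?_
  dsimp only at hlt
  have hx := hout x
  have hy := hout y
  rcases le_total x (Quotient.mk s y).out with h₁ | h₁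
  · exact hr.trans (hconv _ _ _ h₁ hlt.le (hr.symm hx)) hy
  · exact hr.trans (hr.symm (hconv _ _ _ h₁ hxy hy)) hy

theorem exists_isSquare_between {x y : ℚ} (hx : 0 < x) (hxy : x < y) :
    ∃ z, x < z ∧ z < y ∧ IsSquare z := by
  obtain ⟨q, -, h₁, h₂⟩ := exists_rat_pow_btwn two_ne_zero hxy (hx.trans hxy)
  exact ⟨q ^ 2, by exact_mod_cast h₁, by exact_mod_cast h₂, q, sq q⟩

theorem not_isSquare_two_mul {z : ℚ} (hz : z ≠ 0) (h : IsSquare z) : ¬ IsSquare (2 * z) := by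
  rintro ⟨a, ha⟩
  obtain ⟨b, rfl⟩ := h
  have hb : b ≠ 0 := by
    rintro rfl
    simp at hz
  refine irrational_sqrt_two ⟨|a / b|, ?_⟩
  have : (2 : ℚ) = |a / b| ^ 2 := by
    rw [sq_abs]
    field_simp
    linear_combination ha
  have h2 : (2 : ℝ) = ((|a / b| : ℚ) : ℝ) ^ 2 := by exact_mod_cast this
  rw [h2, Real.sqrt_sq]
  exact_mod_cast abs_nonneg (a / b)

/-- A countable dense order can be partitioned into two dense sets. -/
theorem exists_bool_coloring (Q : Type*) [LinearOrder Q] [Countable Q] [DenselyOrdered Q] :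
    ∃ κ : Q → Bool, ∀ x y, x < y → ∀ b, ∃ z, x < z ∧ z < y ∧ κ z = b := by
  classical
  -- Without its endpoints the order is empty or a copy of the positive rationals. There the squares
  -- are dense, and so are the doubles of squares, which are not squares.
  let Q₀ := {q : Q // (∃ t, t < q) ∧ ∃ t, q < t}
  have hden : DenselyOrdered Q₀ := ⟨fun x y hxy => by
    obtain ⟨z, h₁, h₂⟩ := exists_between (show x.1 < y.1 from hxy)
    exact ⟨⟨z, ⟨_, h₁⟩, ⟨_, h₂⟩⟩, h₁, h₂⟩⟩
  have hmin : NoMinOrder Q₀ := ⟨fun x => by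
    obtain ⟨t, ht⟩ := x.2.1
    obtain ⟨z, h₁, h₂⟩ := exists_between ht
    exact ⟨⟨z, ⟨_, h₁⟩, ⟨_, h₂⟩⟩, h₂⟩⟩
  have hmax : NoMaxOrder Q₀ := ⟨fun x => by
    obtain ⟨t, ht⟩ := x.2.2
    obtain ⟨z, h₁, h₂⟩ := exists_between ht
    exact ⟨⟨z, ⟨_, h₁⟩, ⟨_, h₂⟩⟩, h₁⟩⟩
  by_cases hne : Nonempty Q₀
  swap
  · refine ⟨fun _ => true, fun x y hxy => (hne ?_).elim⟩
    obtain ⟨z, h₁, h₂⟩ := exists_between hxy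
    exact ⟨⟨z, ⟨_, h₁⟩, ⟨_, h₂⟩⟩⟩
  have : Nonempty (Set.Ioi (0 : ℚ)) := ⟨⟨1, by simp⟩⟩
  obtain ⟨e⟩ := Order.iso_of_countable_dense Q₀ (Set.Ioi (0 : ℚ))
  refine ⟨fun q => if h : _ then decide (IsSquare (e ⟨q, h⟩).1) else true, fun x y hxy b => ?_⟩
  obtain ⟨x', hx, hx'⟩ := exists_between hxy
  obtain ⟨y', hy, hy'⟩ := exists_between hx'
  have hlt : (e ⟨x', ⟨_, hx⟩, ⟨_, hx'⟩⟩).1 < (e ⟨y', ⟨_, hy⟩, ⟨_, hy'⟩⟩).1 := e.lt_iff_lt.2 hy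
  have hpos : (0 : ℚ) < (e ⟨x', ⟨_, hx⟩, ⟨_, hx'⟩⟩).1 := (e _).2
  obtain ⟨z, h₁, h₂, hz⟩ : ∃ z, (e ⟨x', ⟨_, hx⟩, ⟨_, hx'⟩⟩).1 < z ∧
      z < (e ⟨y', ⟨_, hy⟩, ⟨_, hy'⟩⟩).1 ∧ decide (IsSquare z) = b := by
    cases b
    · obtain ⟨z, h₁, h₂, hz⟩ := exists_isSquare_between (half_pos hpos)
        (div_lt_div_of_pos_right hlt two_pos)
      refine ⟨2 * z, by linarith, by linarith, ?_⟩
      simpa using not_isSquare_two_mul ((half_pos hpos).trans h₁).ne' hz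
    · obtain ⟨z, h₁, h₂, hz⟩ := exists_isSquare_between hpos hlt
      exact ⟨z, h₁, h₂, by simpa using hz⟩
  let t := e.symm ⟨z, hpos.trans h₁⟩
  have ht₁ : (⟨x', ⟨_, hx⟩, ⟨_, hx'⟩⟩ : Q₀) < t := e.lt_symm_apply.2 h₁
  have ht₂ : t < (⟨y', ⟨_, hy⟩, ⟨_, hy'⟩⟩ : Q₀) := e.symm_apply_lt.2 h₂
  refine ⟨t.1, hx.trans ht₁, lt_trans ht₂ hy', ?_⟩
  refine (dif_pos t.2).trans ?_
  simpa [t] using hz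

/-! ### Shuffled subwords -/

section Block

variable {α κ : Type*} [LinearOrder α]

/-- The largest convex subset of `I` around `x` on which the colouring is constant. -/
def block (c : α → κ) (I : Set α) (x : α) : Set α :=
  {y | y ∈ I ∧ ∀ z, (x ≤ z ∧ z ≤ y ∨ y ≤ z ∧ z ≤ x) → c z = c x}

/-- The blocks of the colouring form a shuffle of the colours in `P`. -/
structure IsShuffled (c : α → κ) (I : Set α) (P : Set κ) : Prop where
  mem : ∀ x ∈ I, c x ∈ P
  exists_lt : ∀ x ∈ I, ∃ y ∈ I, y < x ∧ y ∉ block c I x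
  exists_gt : ∀ x ∈ I, ∃ y ∈ I, x < y ∧ y ∉ block c I x
  exists_between : ∀ x ∈ I, ∀ y ∈ I, x < y → y ∉ block c I x → ∀ p ∈ P,
    ∃ z ∈ I, x < z ∧ z < y ∧ z ∉ block c I x ∧ y ∉ block c I z ∧ c z = p

theorem block_equivalence (c : α → κ) (I : Set α) :
    Equivalence fun x y : I => y.1 ∈ block c I x.1 where
  refl x := ⟨x.2, fun z hz => by
    obtain rfl : z = x.1 := hz.elim (fun h => le_antisymm h.2 h.1) fun h => le_antisymm h.2 h.1
    rfl⟩
  symm {x y} h := ⟨x.2, fun z hz => by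
    rw [h.2 z hz.symm,
      h.2 y.1 ((le_total x.1 y.1).imp (fun h => ⟨h, le_rfl⟩) fun h => ⟨le_rfl, h⟩)]⟩
  trans {x y z} h₁ h₂ := ⟨z.2, fun t ht => by
    have hy : c y.1 = c x.1 :=
      h₁.2 y.1 ((le_total x.1 y.1).imp (fun h => ⟨h, le_rfl⟩) fun h => ⟨le_rfl, h⟩)
    by_cases ht' : x.1 ≤ t ∧ t ≤ y.1 ∨ y.1 ≤ t ∧ t ≤ x.1
    · exact h₁.2 t ht'
    · rw [← hy]
      refine h₂.2 t ?_
      rcases le_total t y.1 with h | h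
      · rcases ht with ht | ht
        · exact (ht' (Or.inl ⟨ht.1, h⟩)).elim
        · exact Or.inr ⟨ht.1, h⟩
      · rcases ht with ht | ht
        · exact Or.inl ⟨h, ht.2⟩
        · exact (ht' (Or.inr ⟨h, ht.2⟩)).elim⟩

end Block

namespace CircSemigroup

variable {E : Prop} {S : Type u} {M : CircSemigroup E S} {α : Type} [LinearOrder α] [Countable α]
  (f : α → M.Carrier)

/-- Blocks are the classes of a convex equivalence, and their quotient order is a genuine shuffle.
The detour through `IsShuffled` keeps the hypothesis a statement about positions and colours, which
MSO can express. -/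
theorem value_isShuffled {κ : Type v} (g : κ → M.Carrier) {c : α → κ} {I : Set α} {P : Set κ}
    (hI : I.Nonempty) (h : IsShuffled c I P) (hg : ∀ x ∈ I, value f (block c I x) = g (c x)) :
    value f I = shuffle g P := by
  obtain ⟨ρ, hρ, hρρ, hiff⟩ := exists_monotone_rep (block_equivalence c I)
    (fun x y z hxy hyz h => ⟨y.2, fun t ht => h.2 t (by
      rcases ht with ht | ht
      · exact Or.inl ⟨ht.1, ht.2.trans hyz⟩
      · exact Or.inl ⟨le_antisymm ((show x.1 ≤ y.1 from hxy).trans ht.1) ht.2 ▸ le_rfl,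
          ht.2.trans ((show x.1 ≤ y.1 from hxy).trans hyz)⟩)⟩)
  have := hI.to_subtype
  let Q := Set.range ρ
  have hQ : ∀ q : Q, ρ q.1 = q.1 := by
    rintro ⟨_, x, rfl⟩
    exact hρρ x
  have hlt : ∀ {x y : I}, ρ x < ρ y → x < y := fun h => lt_of_not_ge fun h' => (hρ h').not_gt h
  have hlt' : ∀ {x y : I}, x < y → y.1 ∉ block c I x.1 → ρ x < ρ y := fun {x y} h h' =>
    lt_of_le_of_ne (hρ h.le) fun he => h' ((hiff x y).2 he)
  have hcol : ∀ x : I, c (ρ x).1 = c x.1 := fun x =>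
    ((hiff x (ρ x)).2 (hρρ x).symm).2 _
      ((le_total x (ρ x)).imp (fun h => ⟨h, le_rfl⟩) fun h => ⟨le_rfl, h⟩)
  refine value_eq_shuffle f g P (Q := Q) (fun x => ⟨ρ x, x, rfl⟩) (fun x y hxy => hρ hxy) ?_
    (fun q => c q.1.1) ⟨fun q => h.mem _ q.1.2, fun q => ?_, fun q => ?_,
      fun q q' hqq p hp => ?_⟩ fun q => ?_
  · rintro ⟨_, x, rfl⟩
    exact ⟨x, rfl⟩
  · obtain ⟨y, hy, hyx, hb⟩ := h.exists_lt q.1.1 q.1.2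
    refine ⟨⟨ρ ⟨y, hy⟩, _, rfl⟩, ?_⟩
    change ρ ⟨y, hy⟩ < q.1
    rw [← hQ q]
    exact hlt' hyx fun hb' => hb ((block_equivalence c I).symm (x := ⟨y, hy⟩) (y := q.1) hb')
  · obtain ⟨y, hy, hyx, hb⟩ := h.exists_gt q.1.1 q.1.2
    refine ⟨⟨ρ ⟨y, hy⟩, _, rfl⟩, ?_⟩
    change q.1 < ρ ⟨y, hy⟩
    rw [← hQ q]
    exact hlt' hyx hb
  · have hqq' : q.1 < q'.1 := hqq
    obtain ⟨z, hz, h₁, h₂, h₃, h₄, hc⟩ := h.exists_between q.1.1 q.1.2 q'.1.1 q'.1.2 hqq'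
      (fun hb => hqq'.ne (by rw [← hQ q, ← hQ q']; exact (hiff _ _).1 hb)) p hp
    refine ⟨⟨ρ ⟨z, hz⟩, _, rfl⟩, ?_, ?_, (hcol _).trans hc⟩
    · change q.1 < ρ ⟨z, hz⟩
      rw [← hQ q]
      exact hlt' h₁ h₃
    · change ρ ⟨z, hz⟩ < q'.1
      rw [← hQ q']
      exact hlt' h₂ h₄
  · rw [← hg q.1.1 q.1.2]
    congr 1
    ext x
    constructor
    · rintro ⟨hx, hq⟩
      refine (hiff q.1 ⟨x, hx⟩).2 ?_
      rw [hQ q, ← hq]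
    · intro hx
      refine ⟨hx.1, Subtype.ext ?_⟩
      have := (hiff q.1 ⟨x, hx.1⟩).1 hx
      rw [hQ q] at this
      exact this.symm

/-! ### Relations closed under the products -/

/-- The relation `R` between intervals and values contains the one-letter words and is closed under
binary products, `ω`-powers, `ω*`-powers and shuffles. -/
structure IsClosedRel (f : α → M.Carrier) (R : Set α → WithOne M.Carrier → Prop) : Prop where
  singleton : ∀ x, R {x} (f x)
  -- Convexity is demanded because the intended relations are correct on intervals only.
  union : ∀ I J : Set α, I.Nonempty → J.Nonempty → I.OrdConnected → J.OrdConnected →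
    (I ∪ J).OrdConnected → (∀ x ∈ I, ∀ y ∈ J, x < y) → ∀ s t, R I s → R J t → R (I ∪ J) (s * t)
  upper : ∀ Z : Set α, ∀ z ∈ Z, (∀ x ∈ Z, ∃ y ∈ Z, x < y) → ∀ e,
    (∀ x ∈ Z, ∀ y ∈ Z, x < y → R (Set.Ico x y) e) → R (upper Z z) (omega e)
  lower : ∀ Z : Set α, ∀ z ∈ Z, (∀ x ∈ Z, ∃ y ∈ Z, y < x) → ∀ e,
    (∀ x ∈ Z, ∀ y ∈ Z, x < y → R (Set.Ico x y) e) → R (lower Z z) (omegaStar e)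
  -- The Boolean component separates classes with equal values: the factors of a shuffle can then be
  -- recovered as blocks even if a single value occurs.
  shuffle : ∀ I : Set α, I.Nonempty → I.OrdConnected → ∀ (c : α → M.Carrier × Bool) (P : Set _),
    IsShuffled c I P → (∀ x ∈ I, R (block c I x) (c x).1) → R I (shuffle Prod.fst P)

theorem isClosedRel_value : IsClosedRel f fun I s => value f I = s where
  singleton := value_singleton f
  union I J _ _ _ _ _ h s t hs ht := by rw [value_union f h, hs, ht]
  upper Z z hz hmax e he := value_upper f hz hmax he
  lower Z z hz hmin e he := value_lower f hz hmin he
  shuffle I hI _ c P h hc := value_isShuffled f Prod.fst hI h hc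

/-- `R` contains the value of `I`, unless `I` is empty. -/
def Ok (f : α → M.Carrier) (R : Set α → WithOne M.Carrier → Prop) (I : Set α) : Prop :=
  I.Nonempty → R I (value f I)

/-- `R` contains the values of all intervals inside `I`. -/
def Good (f : α → M.Carrier) (R : Set α → WithOne M.Carrier → Prop) (I : Set α) : Prop :=
  ∀ K ⊆ I, K.OrdConnected → Ok f R K

/-! ### Closed relations contain all values: the condensation argument -/

namespace IsClosedRel

variable {f} {R : Set α → WithOne M.Carrier → Prop}

theorem ok_union (hR : IsClosedRel f R) {I J : Set α} (hI : I.OrdConnected) (hJ : J.OrdConnected)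
    (hIJ : (I ∪ J).OrdConnected) (h : ∀ x ∈ I, ∀ y ∈ J, x < y) (hI' : Ok f R I) (hJ' : Ok f R J) :
    Ok f R (I ∪ J) := by
  rcases I.eq_empty_or_nonempty with rfl | hne
  · simpa using hJ'
  rcases J.eq_empty_or_nonempty with rfl | hne'
  · simpa using hI'
  intro _
  rw [value_union f h]
  exact hR.union I J hne hne' hI hJ hIJ h _ _ (hI' hne) (hJ' hne')

theorem good_union (hR : IsClosedRel f R) {I J : Set α} (hI : I.OrdConnected)
    (hJ : J.OrdConnected) (h : ∀ x ∈ I, ∀ y ∈ J, x < y) (hI' : Good f R I) (hJ' : Good f R J) :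
    Good f R (I ∪ J) := by
  intro K hK hKc
  have hKeq : K = K ∩ I ∪ K ∩ J := by rw [← Set.inter_union_distrib_left, Set.inter_eq_left.2 hK]
  rw [hKeq]
  refine hR.ok_union (hKc.inter hI) (hKc.inter hJ) (hKeq ▸ hKc)
    (fun x hx y hy => h x hx.2 y hy.2) (hI' _ Set.inter_subset_right (hKc.inter hI))
    (hJ' _ Set.inter_subset_right (hKc.inter hJ))

/-- If `K` has no last point, Ramsey's theorem for a cofinal sequence yields a bounded interval
followed by an `ω`-power. -/
theorem ok_inter_Ici [Finite S] (hR : IsClosedRel f R) {K : Set α} (hK : K.OrdConnected)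
    (h : ∀ x ∈ K, ∀ y ∈ K, x ≤ y → Good f R (Set.Icc x y)) {x : α} (hx : x ∈ K) :
    Ok f R (K ∩ Set.Ici x) := by
  by_cases hmax : ∃ y ∈ K, ∀ z ∈ K, z ≤ y
  · obtain ⟨y, hy, hmax⟩ := hmax
    exact h x hx y hy (hmax x hx) _ (fun z hz => ⟨hz.2, hmax z hz.1⟩)
      (hK.inter Set.ordConnected_Ici)
  push Not at hmax
  obtain ⟨u, hu, hu0, huK, hcof⟩ := exists_strictMono_seq hx hmax
  obtain ⟨e, φ, hφ, he⟩ :=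
    exists_strictMono_homogeneous fun i j => value f (Set.Ico (u i) (u j))
  have hmono : StrictMono (u ∘ φ) := hu.comp hφ
  have he' : ∀ y ∈ Set.range (u ∘ φ), ∀ z ∈ Set.range (u ∘ φ), y < z →
      value f (Set.Ico y z) = e := by
    rintro _ ⟨i, rfl⟩ _ ⟨j, rfl⟩ hij
    exact he i j (hmono.lt_iff_lt.1 hij)
  have hnomax : ∀ y ∈ Set.range (u ∘ φ), ∃ z ∈ Set.range (u ∘ φ), y < z := by
    rintro _ ⟨i, rfl⟩
    exact ⟨_, ⟨i + 1, rfl⟩, hmono (Nat.lt_succ_self i)⟩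
  have hZK : Set.range (u ∘ φ) ⊆ K := by
    rintro _ ⟨i, rfl⟩
    exact huK _
  have hx0 : x ≤ u (φ 0) := hu0 ▸ hu.monotone (Nat.zero_le _)
  have hcof' : ∀ y ∈ K, ∃ z ∈ Set.range (u ∘ φ), y < z := fun y hy => by
    obtain ⟨n, hn⟩ := hcof y hy
    exact ⟨_, ⟨n, rfl⟩, hn.trans_le (hu.monotone (hφ.le_apply))⟩
  have heq : K ∩ Set.Ici x =
      Set.Ico x (u (φ 0)) ∪ CircWord.upper (Set.range (u ∘ φ)) (u (φ 0)) := by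
    ext y
    constructor
    · rintro ⟨hy, hxy⟩
      rcases lt_or_ge y (u (φ 0)) with hlt | hge
      · exact Or.inl ⟨hxy, hlt⟩
      · exact Or.inr ⟨hge, hcof' y hy⟩
    · rintro (⟨h₁, h₂⟩ | ⟨h₁, z, hz, h₂⟩)
      · exact ⟨hK.out hx (huK _) ⟨h₁, h₂.le⟩, h₁⟩
      · exact ⟨hK.out (huK _) (hZK hz) ⟨h₁, h₂.le⟩, hx0.trans h₁⟩
  have hKx := hK.inter (Set.ordConnected_Ici (a := x))
  rw [heq] at hKx ⊢
  refine hR.ok_union Set.ordConnected_Ico (upper_ordConnected _ _) hKx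
    (fun y hy z hz => hy.2.trans_le hz.1)
    (h x hx _ (huK _) hx0 _ Set.Ico_subset_Icc_self Set.ordConnected_Ico) fun _ => ?_
  have hz : u (φ 0) ∈ Set.range (u ∘ φ) := ⟨0, rfl⟩
  rw [value_upper f hz hnomax he']
  refine hR.upper _ _ hz hnomax e fun y hy z hz hyz => ?_
  rw [← he' y hy z hz hyz]
  exact h y (hZK hy) z (hZK hz) hyz.le _ Set.Ico_subset_Icc_self Set.ordConnected_Ico
    (Set.nonempty_Ico.2 hyz)

theorem ok_inter_Iio [Finite S] (hR : IsClosedRel f R) {K : Set α} (hK : K.OrdConnected)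
    (h : ∀ x ∈ K, ∀ y ∈ K, x ≤ y → Good f R (Set.Icc x y)) {x : α} (hx : x ∈ K) :
    Ok f R (K ∩ Set.Iio x) := by
  by_cases hmin : ∃ y ∈ K, ∀ z ∈ K, y ≤ z
  · obtain ⟨y, hy, hmin⟩ := hmin
    exact h y hy x hx (hmin x hx) _ (fun z hz => ⟨hmin z hz.1, le_of_lt hz.2⟩)
      (hK.inter Set.ordConnected_Iio)
  push Not at hmin
  obtain ⟨u, hu, hu0, huK, hcof⟩ := exists_strictAnti_seq hx hmin
  obtain ⟨e, φ, hφ, he⟩ :=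
    exists_strictMono_homogeneous fun i j => value f (Set.Ico (u j) (u i))
  have hanti : StrictAnti (u ∘ φ) := hu.comp_strictMono hφ
  have he' : ∀ y ∈ Set.range (u ∘ φ), ∀ z ∈ Set.range (u ∘ φ), y < z →
      value f (Set.Ico y z) = e := by
    rintro _ ⟨i, rfl⟩ _ ⟨j, rfl⟩ hij
    exact he j i (hanti.lt_iff_gt.1 hij)
  have hnomin : ∀ y ∈ Set.range (u ∘ φ), ∃ z ∈ Set.range (u ∘ φ), z < y := by
    rintro _ ⟨i, rfl⟩
    exact ⟨_, ⟨i + 1, rfl⟩, hanti (Nat.lt_succ_self i)⟩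
  have hZK : Set.range (u ∘ φ) ⊆ K := by
    rintro _ ⟨i, rfl⟩
    exact huK _
  have hx0 : u (φ 0) ≤ x := hu0 ▸ hu.antitone (Nat.zero_le _)
  have hcof' : ∀ y ∈ K, ∃ z ∈ Set.range (u ∘ φ), z < y := fun y hy => by
    obtain ⟨n, hn⟩ := hcof y hy
    exact ⟨_, ⟨n, rfl⟩, (hu.antitone (hφ.le_apply)).trans_lt hn⟩
  have heq : K ∩ Set.Iio x =
      CircWord.lower (Set.range (u ∘ φ)) (u (φ 0)) ∪ Set.Ico (u (φ 0)) x := by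
    ext y
    constructor
    · rintro ⟨hy, hxy⟩
      rcases lt_or_ge y (u (φ 0)) with hlt | hge
      · obtain ⟨z, hz, hzy⟩ := hcof' y hy
        exact Or.inl ⟨hlt, z, hz, hzy.le⟩
      · exact Or.inr ⟨hge, hxy⟩
    · rintro (⟨h₁, z, hz, h₂⟩ | ⟨h₁, h₂⟩)
      · exact ⟨hK.out (hZK hz) (huK _) ⟨h₂, h₁.le⟩, h₁.trans_le hx0⟩
      · exact ⟨hK.out (huK _) hx ⟨h₁, h₂.le⟩, h₂⟩
  have hKx := hK.inter (Set.ordConnected_Iio (a := x))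
  rw [heq] at hKx ⊢
  refine hR.ok_union (lower_ordConnected _ _) Set.ordConnected_Ico hKx
    (fun y hy z hz => hy.1.trans_le hz.1)
    (fun _ => ?_) (h _ (huK _) x hx hx0 _ Set.Ico_subset_Icc_self Set.ordConnected_Ico)
  have hz : u (φ 0) ∈ Set.range (u ∘ φ) := ⟨0, rfl⟩
  rw [value_lower f hz hnomin he']
  refine hR.lower _ _ hz hnomin e fun y hy z hz hyz => ?_
  rw [← he' y hy z hz hyz]
  exact h y (hZK hy) z (hZK hz) hyz.le _ Set.Ico_subset_Icc_self Set.ordConnected_Ico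
    (Set.nonempty_Ico.2 hyz)

theorem good_of_Icc [Finite S] (hR : IsClosedRel f R) {C : Set α}
    (h : ∀ x ∈ C, ∀ y ∈ C, x ≤ y → Good f R (Set.Icc x y)) : Good f R C := by
  intro K hKC hK hne
  obtain ⟨x, hx⟩ := hne
  have h' : ∀ x ∈ K, ∀ y ∈ K, x ≤ y → Good f R (Set.Icc x y) := fun x hx y hy =>
    h x (hKC hx) y (hKC hy)
  have heq : K = K ∩ Set.Iio x ∪ K ∩ Set.Ici x := by
    rw [← Set.inter_union_distrib_left, Set.Iio_union_Ici, Set.inter_univ]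
  have hok : Ok f R (K ∩ Set.Iio x ∪ K ∩ Set.Ici x) :=
    hR.ok_union (hK.inter Set.ordConnected_Iio) (hK.inter Set.ordConnected_Ici) (heq ▸ hK)
      (fun y hy z hz => lt_of_lt_of_le hy.2 hz.2) (hR.ok_inter_Iio hK h' hx)
      (hR.ok_inter_Ici hK h' hx)
  rw [← heq] at hok
  exact hok ⟨x, hx⟩

theorem good_mono {I J : Set α} (h : Good f R J) (hIJ : I ⊆ J) : Good f R I :=
  fun K hK => h K (hK.trans hIJ)

theorem good_Icc_trans (hR : IsClosedRel f R) {x y z : α}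
    (h₁ : Good f R (Set.Icc x y)) (h₂ : Good f R (Set.Icc y z)) : Good f R (Set.Icc x z) := by
  refine good_mono (hR.good_union (J := Set.Ioc y z) Set.ordConnected_Icc Set.ordConnected_Ioc
    (fun s hs t ht => hs.2.trans_lt ht.1) h₁ (good_mono h₂ Set.Ioc_subset_Icc_self)) ?_
  intro t ht
  rcases le_or_gt t y with h | h
  · exact Or.inl ⟨ht.1, h⟩
  · exact Or.inr ⟨h, ht.2⟩

/-- Naming both intervals makes the relation symmetric; at least one of them has at most one point.
-/
theorem equivalence_good (hR : IsClosedRel f R) :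
    Equivalence fun x y => Good f R (Set.Icc x y) ∧ Good f R (Set.Icc y x) where
  refl x := by
    have : Good f R (Set.Icc x x) := fun K hK _ hne => by
      rw [Set.Icc_self] at hK
      rw [(Set.subset_singleton_iff_eq.1 hK).resolve_left hne.ne_empty, value_singleton]
      exact hR.singleton x
    exact ⟨this, this⟩
  symm h := ⟨h.2, h.1⟩
  trans h₁ h₂ := ⟨hR.good_Icc_trans h₁.1 h₂.1, hR.good_Icc_trans h₂.2 h₁.2⟩

/-- The relation contains the value of every interval in the union of the classes of a
condensation, provided that the classes are good and that they form a shuffle. -/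
theorem good_of_shuffle (hR : IsClosedRel f R) {ρ : α → α} (hρ : Monotone ρ)
    (hgood : ∀ x, Good f R {y | ρ y = ρ x}) (c : α → M.Carrier × Bool)
    (hc : ∀ x, c (ρ x) = c x) (hval : ∀ x, value f {y | ρ y = ρ x} = (c x).1)
    {C : Set α} {P : Set (M.Carrier × Bool)} (hmem : ∀ x ∈ C, c x ∈ P)
    (hP : ∀ x ∈ C, ∀ y ∈ C, ρ x < ρ y → ∀ p ∈ P, ∃ z, ρ x < ρ z ∧ ρ z < ρ y ∧ c z = p)
    (hP' : ∀ p ∈ P, ∃ q ∈ P, q ≠ p) : Good f R C := by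
  have hlt : ∀ {x y : α}, ρ x < ρ y → x < y := fun h => lt_of_not_ge fun h' => (hρ h').not_gt h
  have hconv : ∀ x, {y | ρ y = ρ x}.OrdConnected := fun x => ⟨fun y hy z hz t ht =>
    le_antisymm ((hρ ht.2).trans_eq hz) ((Eq.symm hy : ρ x = ρ y).trans_le (hρ ht.1))⟩
  -- Without a first or last class, `K` contains every class that it meets. A second colour occurs
  -- between any two classes, so the blocks of `c` in `K` are exactly the classes.
  have hopen : ∀ K ⊆ C, K.OrdConnected → (∀ x ∈ K, ∃ y ∈ K, ρ y < ρ x) →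
      (∀ x ∈ K, ∃ y ∈ K, ρ x < ρ y) → Ok f R K := by
    intro K hKC hK hmin hmax hne
    have hclass : ∀ x ∈ K, ∀ y, ρ y = ρ x → y ∈ K := fun x hx y hy => by
      obtain ⟨s, hs, hsx⟩ := hmin x hx
      obtain ⟨t, ht, hxt⟩ := hmax x hx
      exact hK.out hs ht ⟨(hlt (hy ▸ hsx)).le, (hlt (hy ▸ hxt)).le⟩
    have hne_block : ∀ x ∈ K, ∀ y ∈ K, ρ x < ρ y →
        ∃ z, x ≤ z ∧ z ≤ y ∧ c z ≠ c x := fun x hx y hy hxy => by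
      obtain ⟨q, hq, hqx⟩ := hP' _ (hmem x (hKC hx))
      obtain ⟨z, hz₁, hz₂, hz⟩ := hP x (hKC hx) y (hKC hy) hxy q hq
      exact ⟨z, (hlt hz₁).le, (hlt hz₂).le, hz ▸ hqx⟩
    have hblock : ∀ x ∈ K, block c K x = {y | ρ y = ρ x} := fun x hx => by
      ext y
      constructor
      · rintro ⟨hy, hcol⟩
        by_contra hne
        have hcy : c y = c x :=
          hcol y ((le_total x y).imp (fun h => ⟨h, le_rfl⟩) fun h => ⟨le_rfl, h⟩)
        rcases lt_or_gt_of_ne hne with h | h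
        · obtain ⟨z, hz₁, hz₂, hz⟩ := hne_block y hy x hx h
          exact hz ((hcol z (Or.inr ⟨hz₁, hz₂⟩)).trans hcy.symm)
        · obtain ⟨z, hz₁, hz₂, hz⟩ := hne_block x hx y hy h
          exact hz (hcol z (Or.inl ⟨hz₁, hz₂⟩))
      · intro hy
        have hy' : ρ y = ρ x := hy
        refine ⟨hclass x hx y hy, fun z hz => ?_⟩
        have hzx : ρ z = ρ x := by
          rcases hz with hz | hz
          · exact le_antisymm ((hρ hz.2).trans_eq hy') (hρ hz.1)
          · exact le_antisymm (hρ hz.2) (hy' ▸ hρ hz.1)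
        rw [← hc z, hzx, hc]
    have hsh : IsShuffled c K P := by
      refine ⟨fun x hx => hmem x (hKC hx), fun x hx => ?_, fun x hx => ?_,
        fun x hx y hy hxy hb p hp => ?_⟩
      · obtain ⟨y, hy, hyx⟩ := hmin x hx
        refine ⟨y, hy, hlt hyx, ?_⟩
        rw [hblock x hx]
        exact hyx.ne
      · obtain ⟨y, hy, hyx⟩ := hmax x hx
        refine ⟨y, hy, hlt hyx, ?_⟩
        rw [hblock x hx]
        exact hyx.ne'
      · rw [hblock x hx] at hb
        obtain ⟨z, hz₁, hz₂, hz⟩ := hP x (hKC hx) y (hKC hy)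
          (lt_of_le_of_ne (hρ hxy.le) fun h => hb h.symm) p hp
        have hzK : z ∈ K := hK.out hx hy ⟨(hlt hz₁).le, (hlt hz₂).le⟩
        refine ⟨z, hzK, hlt hz₁, hlt hz₂, ?_, ?_, hz⟩
        · rw [hblock x hx]
          exact hz₁.ne'
        · rw [hblock z hzK]
          exact hz₂.ne'
    rw [value_isShuffled f Prod.fst hne hsh fun x hx => by rw [hblock x hx, hval]]
    refine hR.shuffle K hne hK c P hsh fun x hx => ?_
    rw [hblock x hx, ← hval]
    exact hgood x _ subset_rfl (hconv x) ⟨x, rfl⟩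
  have hP₀ : ∀ x ∈ C, ∀ y ∈ C, ρ x < ρ y → ∃ z, ρ x < ρ z ∧ ρ z < ρ y := fun x hx y hy hxy => by
    obtain ⟨z, h₁, h₂, -⟩ := hP x hx y hy hxy _ (hmem x hx)
    exact ⟨z, h₁, h₂⟩
  -- A first class, which `K` may meet only partly, is split off as a good factor; by density the
  -- rest has no first class. The last class is treated in the same way afterwards.
  have hright : ∀ K ⊆ C, K.OrdConnected → (∀ x ∈ K, ∃ y ∈ K, ρ x < ρ y) → Ok f R K := by
    intro K hKC hK hmax
    by_cases hmin : ∃ x ∈ K, ∀ y ∈ K, ρ x ≤ ρ y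
    swap
    · push Not at hmin
      exact hopen K hKC hK hmin hmax
    obtain ⟨x, hx, hmin⟩ := hmin
    have heq : K = K ∩ {y | ρ y = ρ x} ∪ K ∩ {y | ρ x < ρ y} := by
      ext y
      constructor
      · intro hy
        rcases (hmin y hy).eq_or_lt with h | h
        · exact Or.inl ⟨hy, h.symm⟩
        · exact Or.inr ⟨hy, h⟩
      · rintro (h | h) <;> exact h.1
    have hK' : (K ∩ {y | ρ x < ρ y}).OrdConnected :=
      hK.inter ⟨fun y hy z hz t ht => lt_of_lt_of_le hy (hρ ht.1)⟩
    have hok : Ok f R (K ∩ {y | ρ y = ρ x} ∪ K ∩ {y | ρ x < ρ y}) := by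
      refine hR.ok_union (hK.inter (hconv x)) hK' (heq ▸ hK) ?_
        (hgood x _ Set.inter_subset_right (hK.inter (hconv x)))
        (hopen _ (Set.inter_subset_left.trans hKC) hK' ?_ ?_)
      · rintro y ⟨-, hy⟩ z ⟨-, hz⟩
        exact hlt ((show ρ y = ρ x from hy).trans_lt hz)
      · rintro y ⟨hyK, hy⟩
        obtain ⟨z, hz₁, hz₂⟩ := hP₀ x (hKC hx) y (hKC hyK) hy
        exact ⟨z, ⟨hK.out hx hyK ⟨(hlt hz₁).le, (hlt hz₂).le⟩, hz₁⟩, hz₂⟩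
      · rintro y ⟨hyK, hy⟩
        obtain ⟨z, hz, hyz⟩ := hmax y hyK
        exact ⟨z, ⟨hz, lt_trans hy hyz⟩, hyz⟩
    rwa [← heq] at hok
  intro K hKC hK
  by_cases hmax : ∃ x ∈ K, ∀ y ∈ K, ρ y ≤ ρ x
  swap
  · push Not at hmax
    exact hright K hKC hK hmax
  obtain ⟨x, hx, hmax⟩ := hmax
  have heq : K = K ∩ {y | ρ y < ρ x} ∪ K ∩ {y | ρ y = ρ x} := by
    ext y
    constructor
    · intro hy
      rcases (hmax y hy).eq_or_lt with h | h
      · exact Or.inr ⟨hy, h⟩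
      · exact Or.inl ⟨hy, h⟩
    · rintro (h | h) <;> exact h.1
  have hK' : (K ∩ {y | ρ y < ρ x}).OrdConnected :=
    hK.inter ⟨fun y hy z hz t ht => lt_of_le_of_lt (hρ ht.2) hz⟩
  have hok : Ok f R (K ∩ {y | ρ y < ρ x} ∪ K ∩ {y | ρ y = ρ x}) := by
    refine hR.ok_union hK' (hK.inter (hconv x)) (heq ▸ hK) ?_
      (hright _ (Set.inter_subset_left.trans hKC) hK' ?_)
      (hgood x _ Set.inter_subset_right (hK.inter (hconv x)))
    · rintro y ⟨-, hy⟩ z ⟨-, hz⟩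
      exact hlt (lt_of_lt_of_eq hy (show ρ z = ρ x from hz).symm)
    · rintro y ⟨hyK, hy⟩
      obtain ⟨z, hz₁, hz₂⟩ := hP₀ y (hKC hyK) x (hKC hx) hy
      exact ⟨z, ⟨hK.out hyK hx ⟨(hlt hz₁).le, (hlt hz₂).le⟩, hz₂⟩, hz₁⟩
  rwa [← heq] at hok

/-- In a dense order with finitely many colours there is an interval in all of whose subintervals
the same colours occur. -/
theorem exists_homogeneous_interval {Q κ : Type*} [LinearOrder Q] [Finite κ] (j : Q → κ) {a b : Q}
    (hab : a < b) : ∃ a' b', a' < b' ∧ ∀ x y, a' ≤ x → x < y → y ≤ b' →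
      j '' Set.Ioo x y = j '' Set.Ioo a' b' := by
  classical
  have hex : ∃ n, ∃ a b : Q, a < b ∧ (j '' Set.Ioo a b).ncard = n := ⟨_, a, b, hab, rfl⟩
  obtain ⟨a', b', hab', hn⟩ := Nat.find_spec hex
  refine ⟨a', b', hab', fun x y hx hxy hy => ?_⟩
  refine Set.eq_of_subset_of_ncard_le (Set.image_mono (Set.Ioo_subset_Ioo hx hy)) ?_
    (Set.toFinite _)
  rw [hn]
  exact Nat.find_min' hex ⟨x, y, hxy, rfl⟩

/-- A relation that is closed under the products contains the value of every interval. -/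
theorem ok [Finite S] (hR : IsClosedRel f R) {I : Set α} (hI : I.OrdConnected) : Ok f R I := by
  obtain ⟨ρ, hρ, hρρ, hiff⟩ := exists_monotone_rep hR.equivalence_good (fun x y z hxy hyz h =>
    ⟨good_mono h.1 (Set.Icc_subset_Icc_right hyz), good_mono (hR.equivalence_good.refl x).1
      (fun t ht => ⟨hxy.trans ht.1, ht.2⟩)⟩)
  have hlt : ∀ {x y : α}, ρ x < ρ y → x < y := fun h => lt_of_not_ge fun h' => (hρ h').not_gt h
  have hconv : ∀ x, {y | ρ y = ρ x}.OrdConnected := fun x => ⟨fun y hy z hz t ht =>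
    le_antisymm ((hρ ht.2).trans_eq hz) ((Eq.symm hy : ρ x = ρ y).trans_le (hρ ht.1))⟩
  have hgood : ∀ x, Good f R {y | ρ y = ρ x} := fun x =>
    hR.good_of_Icc fun y hy z hz _ =>
      ((hiff y z).2 ((show ρ y = ρ x from hy).trans (Eq.symm hz))).1
  suffices hall : ∀ x y, ρ x = ρ y from
    hR.good_of_Icc (fun x _ y _ _ => ((hiff x y).2 (hall x y)).1) I subset_rfl hI
  by_contra hne
  push Not at hne
  obtain ⟨a, b, hab⟩ := hne
  let Q := Set.range ρ
  have hQ : ∀ q : Q, ρ q.1 = q.1 := by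
    rintro ⟨_, x, rfl⟩
    exact hρρ x
  let π : α → Q := fun x => ⟨ρ x, x, rfl⟩
  have hπ : ∀ q : Q, π q.1 = q := fun q => Subtype.ext (hQ q)
  -- Two adjacent classes would have a good union and hence coincide.
  have hdense : DenselyOrdered Q := ⟨fun p q hpq => by
    by_contra hno
    push Not at hno
    have hpq' : p.1 < q.1 := hpq
    have hρpq : ρ p.1 < ρ q.1 := by rwa [hQ, hQ]
    have hg := hR.good_union (hconv p.1) (hconv q.1) (fun x hx y hy => hlt <| by
      rwa [show ρ x = ρ p.1 from hx, show ρ y = ρ q.1 from hy]) (hgood p.1) (hgood q.1)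
    have hpq'' : ρ p.1 = ρ q.1 := by
      refine (hiff _ _).1 ⟨good_mono hg fun t ht => ?_, fun K hK _ hne => ?_⟩
      · rcases (hρ ht.1).eq_or_lt with h | h
        · exact Or.inl h.symm
        · refine Or.inr (le_antisymm (hρ ht.2) ?_)
          have := hno (π t) (show p.1 < ρ t by rwa [← hQ p])
          rw [hQ q]
          exact this
      · obtain ⟨t, ht⟩ := hne
        exact (((hK ht).1.trans (hK ht).2).not_gt hpq').elim
    exact hρpq.ne hpq''⟩
  obtain ⟨κ, hκ⟩ := exists_bool_coloring Q
  choose v hv using fun x => exists_value_eq_coe f (I := {y | ρ y = ρ x}) ⟨x, rfl⟩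
  have hab' : ∃ p q : Q, p < q := by
    rcases lt_or_gt_of_ne hab with h | h
    · exact ⟨π a, π b, h⟩
    · exact ⟨π b, π a, h⟩
  obtain ⟨p, q, hpq⟩ := hab'
  -- Between `a'` and `b'` the same colours occur everywhere, so the classes there form a shuffle.
  -- Their union is good although it contains more than one class, which is the contradiction.
  obtain ⟨a', b', hab', hhom⟩ :=
    exists_homogeneous_interval (fun q : Q => ((v q.1, κ q) : M.Carrier × Bool)) hpq
  let c : α → M.Carrier × Bool := fun x => (v (π x).1, κ (π x))
  have hcQ : ∀ q : Q, c q.1 = (v q.1, κ q) := fun q => by simp only [c, hπ]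
  have hg : Good f R {x | a' < π x ∧ π x < b'} := by
    refine hR.good_of_shuffle hρ hgood c (fun x => ?_) (fun x => ?_)
      (P := (fun q : Q => ((v q.1, κ q) : M.Carrier × Bool)) '' Set.Ioo a' b')
      (fun x hx => ⟨π x, hx, rfl⟩) (fun x hx y hy hxy p hp => ?_) (fun p hp => ?_)
    · exact hcQ (π x)
    · rw [← hv]
      simp only [π, hρρ]
    · rw [← hhom (π x) (π y) hx.1.le hxy hy.2.le] at hp
      obtain ⟨z, hz, rfl⟩ := hp
      refine ⟨z.1, ?_, ?_, hcQ z⟩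
      · rw [hQ]
        exact hz.1
      · rw [hQ]
        exact hz.2
    · obtain ⟨z, h₁, h₂, hz⟩ := hκ a' b' hab' (!p.2)
      exact ⟨_, ⟨z, ⟨h₁, h₂⟩, rfl⟩, fun h => by
        have := congrArg Prod.snd h
        simp [hz] at this⟩
  obtain ⟨x, hx₁, hx₂⟩ := exists_between hab'
  obtain ⟨y, hy₁, hy₂⟩ := exists_between hx₂
  have hxy : x.1 < y.1 := hy₁
  have hρxy : ρ x.1 = ρ y.1 := by
    refine (hiff _ _).1 ⟨good_mono hg fun t ht => ⟨lt_of_lt_of_le hx₁ ?_, lt_of_le_of_lt ?_ hy₂⟩,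
      fun K hK _ hne => ?_⟩
    · rw [← hπ x]
      exact hρ ht.1
    · rw [← hπ y]
      exact hρ ht.2
    · obtain ⟨t, ht⟩ := hne
      exact (((hK ht).1.trans (hK ht).2).not_gt hxy).elim
  rw [hQ, hQ] at hρxy
  exact hxy.ne hρxy

end IsClosedRel

end CircSemigroup

end CircWord

namespace CircWord

/-! ### Definable relations -/

namespace MSO

variable {A : Type u}

/-- A renaming of variables, extended to one more variable. -/
def lift {n n' : ℕ} (i : Fin n → Fin n') : Fin (n + 1) → Fin (n' + 1) :=
  Fin.cons 0 (Fin.succ ∘ i)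

/-- Renaming the free variables of a formula. -/
def rename : {n m n' m' : ℕ} → (Fin n → Fin n') → (Fin m → Fin m') → MSO A n m → MSO A n' m'
  | _, _, _, _, i, _, .le x y => .le (i x) (i y)
  | _, _, _, _, i, _, .letter a x => .letter a (i x)
  | _, _, _, _, i, _, .eq x y => .eq (i x) (i y)
  | _, _, _, _, i, j, .mem x X => .mem (i x) (j X)
  | _, _, _, _, i, j, .not φ => .not (φ.rename i j)
  | _, _, _, _, i, j, .and φ ψ => .and (φ.rename i j) (ψ.rename i j)
  | _, _, _, _, i, j, .or φ ψ => .or (φ.rename i j) (ψ.rename i j)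
  | _, _, _, _, i, j, .allPos φ => .allPos (φ.rename (lift i) j)
  | _, _, _, _, i, j, .exPos φ => .exPos (φ.rename (lift i) j)
  | _, _, _, _, i, j, .allSet φ => .allSet (φ.rename i (lift j))
  | _, _, _, _, i, j, .exSet φ => .exSet (φ.rename i (lift j))

theorem cons_comp_lift {β : Type*} {n n' : ℕ} (i : Fin n → Fin n') (x : β) (ρ : Fin n' → β) :
    (Fin.cons x ρ : Fin (n' + 1) → β) ∘ lift i = Fin.cons x (ρ ∘ i) := by
  funext k
  refine Fin.cases ?_ (fun k => ?_) k <;> simp [lift]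

theorem realize_rename {E : Prop} (w : LabelledOrder E A) {n m n' m' : ℕ} (φ : MSO A n m)
    (i : Fin n → Fin n') (j : Fin m → Fin m') (ρ : Fin n' → w.Pos) (σ : Fin m' → Set w.Pos) :
    (φ.rename i j).Realize w ρ σ ↔ φ.Realize w (ρ ∘ i) (σ ∘ j) := by
  induction φ generalizing n' m' with
  | le | letter | eq | mem => rfl
  | not φ ih => exact not_congr (ih i j ρ σ)
  | and φ ψ ih ih' => exact and_congr (ih i j ρ σ) (ih' i j ρ σ)
  | or φ ψ ih ih' => exact or_congr (ih i j ρ σ) (ih' i j ρ σ)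
  | allPos φ ih =>
    refine forall_congr' fun x => (ih (lift i) j (Fin.cons x ρ) σ).trans ?_
    rw [cons_comp_lift]
  | exPos φ ih =>
    refine exists_congr fun x => (ih (lift i) j (Fin.cons x ρ) σ).trans ?_
    rw [cons_comp_lift]
  | allSet φ ih =>
    refine forall_congr' fun x => (ih i (lift j) ρ (Fin.cons x σ)).trans ?_
    rw [cons_comp_lift]
  | exSet φ ih =>
    refine exists_congr fun x => (ih i (lift j) ρ (Fin.cons x σ)).trans ?_
    rw [cons_comp_lift]

end MSO

/-- Valuations of `n` position variables and `m` set variables. -/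
abbrev Env {E : Prop} {A : Type u} (w : LabelledOrder E A) (n m : ℕ) :=
  (Fin n → w.Pos) × (Fin m → Set w.Pos)

/-- Forgetting the first position variable. -/
def Env.pop {E : Prop} {A : Type u} {w : LabelledOrder E A} {n m : ℕ} (γ : Env w (n + 1) m) :
    Env w n m :=
  (Fin.tail γ.1, γ.2)

/-- Forgetting the first set variable. -/
def Env.popSet {E : Prop} {A : Type u} {w : LabelledOrder E A} {n m : ℕ} (γ : Env w n (m + 1)) :
    Env w n m :=
  (γ.1, Fin.tail γ.2)

/-! ### Closure properties of definability -/

section Definability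

variable {n m n' m' : ℕ} {E : Prop} {A : Type u}

/-- The relation `P` between positions and sets of positions is definable. -/
def Dfn (P : ∀ w : LabelledOrder E A, Env w n m → Prop) : Prop :=
  ∃ φ : MSO A n m, ∀ w γ, φ.Realize w γ.1 γ.2 ↔ P w γ

/-- The position `x` is the value of a variable. -/
def DPos (x : ∀ w : LabelledOrder E A, Env w n m → w.Pos) : Prop :=
  ∃ i, ∀ w γ, x w γ = γ.1 i

/-- The set `X` is definable. -/
def DSet (X : ∀ w : LabelledOrder E A, Env w n m → Set w.Pos) : Prop :=
  Dfn (n := n + 1) fun w γ => γ.1 0 ∈ X w γ.pop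

/-- The colouring `c` is definable. -/
def DCol {Λ : Type v} (c : ∀ w : LabelledOrder E A, Env w n m → w.Pos → Λ) : Prop :=
  ∀ l, DSet fun w γ => {x | c w γ x = l}

/-- The map `d` between valuations is a renaming of variables. -/
def Ren (d : ∀ w : LabelledOrder E A, Env w n' m' → Env w n m) : Prop :=
  ∃ i j, ∀ w γ, d w γ = (γ.1 ∘ i, γ.2 ∘ j)

variable {P P' : ∀ w : LabelledOrder E A, Env w n m → Prop}

theorem Ren.id : Ren fun (w : LabelledOrder E A) (γ : Env w n m) => γ := ⟨_root_.id, _root_.id,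
  fun _ _ => rfl⟩

theorem Ren.pop : Ren fun (w : LabelledOrder E A) (γ : Env w (n + 1) m) => γ.pop :=
  ⟨Fin.succ, _root_.id, fun _ _ => rfl⟩

theorem Ren.popSet : Ren fun (w : LabelledOrder E A) (γ : Env w n (m + 1)) => γ.popSet :=
  ⟨_root_.id, Fin.succ, fun _ _ => rfl⟩

theorem Ren.comp {n'' m'' : ℕ} {d : ∀ w : LabelledOrder E A, Env w n' m' → Env w n m}
    {d' : ∀ w : LabelledOrder E A, Env w n'' m'' → Env w n' m'} (hd : Ren d) (hd' : Ren d') :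
    Ren fun w γ => d w (d' w γ) := by
  obtain ⟨i, j, h⟩ := hd
  obtain ⟨i', j', h'⟩ := hd'
  exact ⟨i' ∘ i, j' ∘ j, fun w γ => (h w _).trans (by rw [h']; rfl)⟩

namespace Dfn

theorem congr (h : Dfn P) (h' : ∀ w γ, P w γ ↔ P' w γ) : Dfn P' := by
  obtain ⟨φ, hφ⟩ := h
  exact ⟨φ, fun w γ => (hφ w γ).trans (h' w γ)⟩

theorem comp {d : ∀ w : LabelledOrder E A, Env w n' m' → Env w n m} (h : Dfn P) (hd : Ren d) :
    Dfn fun w γ => P w (d w γ) := by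
  obtain ⟨φ, hφ⟩ := h
  obtain ⟨i, j, hd⟩ := hd
  refine ⟨φ.rename i j, fun w γ => ?_⟩
  rw [MSO.realize_rename]
  beta_reduce
  rw [hd]
  exact hφ w (γ.1 ∘ i, γ.2 ∘ j)

theorem not (h : Dfn P) : Dfn fun w γ => ¬ P w γ := by
  obtain ⟨φ, hφ⟩ := h
  exact ⟨.not φ, fun w γ => not_congr (hφ w γ)⟩

theorem and (h : Dfn P) (h' : Dfn P') : Dfn fun w γ => P w γ ∧ P' w γ := by
  obtain ⟨φ, hφ⟩ := h
  obtain ⟨ψ, hψ⟩ := h'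
  exact ⟨.and φ ψ, fun w γ => and_congr (hφ w γ) (hψ w γ)⟩

theorem or (h : Dfn P) (h' : Dfn P') : Dfn fun w γ => P w γ ∨ P' w γ := by
  obtain ⟨φ, hφ⟩ := h
  obtain ⟨ψ, hψ⟩ := h'
  exact ⟨.or φ ψ, fun w γ => or_congr (hφ w γ) (hψ w γ)⟩

theorem imp (h : Dfn P) (h' : Dfn P') : Dfn fun w γ => P w γ → P' w γ :=
  (h.not.or h').congr fun _ _ => imp_iff_not_or.symm

theorem iff (h : Dfn P) (h' : Dfn P') : Dfn fun w γ => P w γ ↔ P' w γ :=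
  ((h.imp h').and (h'.imp h)).congr fun _ _ => iff_iff_implies_and_implies.symm

theorem all {Q : ∀ w : LabelledOrder E A, Env w n m → w.Pos → Prop}
    (h : Dfn (n := n + 1) fun w γ => Q w γ.pop (γ.1 0)) : Dfn fun w γ => ∀ x, Q w γ x := by
  obtain ⟨φ, hφ⟩ := h
  exact ⟨.allPos φ, fun w γ => forall_congr' fun x => hφ w (Fin.cons x γ.1, γ.2)⟩

theorem ex {Q : ∀ w : LabelledOrder E A, Env w n m → w.Pos → Prop}
    (h : Dfn (n := n + 1) fun w γ => Q w γ.pop (γ.1 0)) : Dfn fun w γ => ∃ x, Q w γ x := by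
  obtain ⟨φ, hφ⟩ := h
  exact ⟨.exPos φ, fun w γ => exists_congr fun x => hφ w (Fin.cons x γ.1, γ.2)⟩

theorem allSet {Q : ∀ w : LabelledOrder E A, Env w n m → Set w.Pos → Prop}
    (h : Dfn (m := m + 1) fun w γ => Q w γ.popSet (γ.2 0)) : Dfn fun w γ => ∀ X, Q w γ X := by
  obtain ⟨φ, hφ⟩ := h
  exact ⟨.allSet φ, fun w γ => forall_congr' fun X => hφ w (γ.1, Fin.cons X γ.2)⟩

theorem exSet {Q : ∀ w : LabelledOrder E A, Env w n m → Set w.Pos → Prop}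
    (h : Dfn (m := m + 1) fun w γ => Q w γ.popSet (γ.2 0)) : Dfn fun w γ => ∃ X, Q w γ X := by
  obtain ⟨φ, hφ⟩ := h
  exact ⟨.exSet φ, fun w γ => exists_congr fun X => hφ w (γ.1, Fin.cons X γ.2)⟩

theorem const (p : Prop) : Dfn fun (w : LabelledOrder E A) (_ : Env w n m) => p := by
  have htrue : Dfn fun (w : LabelledOrder E A) (_ : Env w n m) => True :=
    -- The quantifier is universal so that the formula also holds in the empty order.
    ⟨.allPos (.eq 0 0), fun w γ => ⟨fun _ => trivial, fun _ x => rfl⟩⟩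
  by_cases hp : p
  · exact htrue.congr fun _ _ => by simp [hp]
  · exact htrue.not.congr fun _ _ => by simp [hp]

theorem exFin {ι : Type*} [Finite ι] {Q : ι → ∀ w : LabelledOrder E A, Env w n m → Prop}
    (h : ∀ i, Dfn (Q i)) : Dfn fun w γ => ∃ i, Q i w γ := by
  classical
  have := Fintype.ofFinite ι
  have key : ∀ s : Finset ι, Dfn fun w γ => ∃ i ∈ s, Q i w γ := by
    intro s
    induction s using Finset.induction_on with
    | empty => exact (const False).congr fun _ _ => by simp
    | insert a s _ ih => exact ((h a).or ih).congr fun _ _ => by simp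
  exact (key Finset.univ).congr fun _ _ => by simp

theorem allFin {ι : Type*} [Finite ι] {Q : ι → ∀ w : LabelledOrder E A, Env w n m → Prop}
    (h : ∀ i, Dfn (Q i)) : Dfn fun w γ => ∀ i, Q i w γ :=
  (exFin fun i => (h i).not).not.congr fun _ _ => by simp

end Dfn

namespace DPos

theorem zero : DPos fun (w : LabelledOrder E A) (γ : Env w (n + 1) m) => γ.1 0 :=
  ⟨0, fun _ _ => rfl⟩

variable {x y : ∀ w : LabelledOrder E A, Env w n m → w.Pos}

theorem comp {d : ∀ w : LabelledOrder E A, Env w n' m' → Env w n m} (hx : DPos x) (hd : Ren d) :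
    DPos fun w γ => x w (d w γ) := by
  obtain ⟨k, hk⟩ := hx
  obtain ⟨i, j, hd⟩ := hd
  exact ⟨i k, fun w γ => (hk w _).trans (by rw [hd]; rfl)⟩

theorem pop (hx : DPos x) : DPos fun w (γ : Env w (n + 1) m) => x w γ.pop := hx.comp Ren.pop

theorem popSet (hx : DPos x) : DPos fun w (γ : Env w n (m + 1)) => x w γ.popSet :=
  hx.comp Ren.popSet

theorem le (hx : DPos x) (hy : DPos y) : Dfn fun w γ => x w γ ≤ y w γ := by
  obtain ⟨i, hi⟩ := hx
  obtain ⟨j, hj⟩ := hy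
  exact ⟨.le i j, fun w γ => by beta_reduce; rw [hi, hj]; rfl⟩

theorem lt (hx : DPos x) (hy : DPos y) : Dfn fun w γ => x w γ < y w γ :=
  (hy.le hx).not.congr fun _ _ => not_le

theorem eq (hx : DPos x) (hy : DPos y) : Dfn fun w γ => x w γ = y w γ := by
  obtain ⟨i, hi⟩ := hx
  obtain ⟨j, hj⟩ := hy
  exact ⟨.eq i j, fun w γ => by beta_reduce; rw [hi, hj]; rfl⟩

end DPos

namespace DSet

theorem zero : DSet fun (w : LabelledOrder E A) (γ : Env w n (m + 1)) => γ.2 0 :=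
  ⟨.mem 0 0, fun _ _ => Iff.rfl⟩

variable {X Y : ∀ w : LabelledOrder E A, Env w n m → Set w.Pos}
  {x y : ∀ w : LabelledOrder E A, Env w n m → w.Pos}

theorem comp {d : ∀ w : LabelledOrder E A, Env w n' m' → Env w n m} (hX : DSet X) (hd : Ren d) :
    DSet fun w γ => X w (d w γ) := by
  obtain ⟨i, j, hd⟩ := hd
  refine Dfn.congr (Dfn.comp hX (d := fun w γ => (γ.1 ∘ MSO.lift i, γ.2 ∘ j))
    ⟨MSO.lift i, j, fun _ _ => rfl⟩) fun w γ => ?_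
  beta_reduce
  rw [hd]
  rfl

theorem pop (hX : DSet X) : DSet fun w (γ : Env w (n + 1) m) => X w γ.pop := hX.comp Ren.pop

theorem popSet (hX : DSet X) : DSet fun w (γ : Env w n (m + 1)) => X w γ.popSet :=
  hX.comp Ren.popSet

theorem _root_.CircWord.Dfn.mem (hx : DPos x) (hX : DSet X) : Dfn fun w γ => x w γ ∈ X w γ := by
  obtain ⟨i, hi⟩ := hx
  refine Dfn.congr (Dfn.comp hX (d := fun w γ => (γ.1 ∘ Fin.cons i id, γ.2))
    ⟨Fin.cons i id, id, fun _ _ => rfl⟩) fun w γ => ?_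
  rw [hi]
  rfl

/-- A set that is described by a definable property is definable. -/
theorem of_dfn {Q : ∀ w : LabelledOrder E A, Env w n m → w.Pos → Prop}
    (h : Dfn (n := n + 1) fun w γ => Q w γ.pop (γ.1 0)) : DSet fun w γ => {x | Q w γ x} := h

theorem univ : DSet fun (w : LabelledOrder E A) (_ : Env w n m) => Set.univ :=
  of_dfn (Dfn.const True)

theorem inter (hX : DSet X) (hY : DSet Y) : DSet fun w γ => X w γ ∩ Y w γ := Dfn.and hX hY

theorem union (hX : DSet X) (hY : DSet Y) : DSet fun w γ => X w γ ∪ Y w γ := Dfn.or hX hY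

theorem singleton (hx : DPos x) : DSet fun w γ => {x w γ} := DPos.zero.eq hx.pop

theorem Ico (hx : DPos x) (hy : DPos y) : DSet fun w γ => Set.Ico (x w γ) (y w γ) :=
  (hx.pop.le DPos.zero).and (DPos.zero.lt hy.pop)

theorem upper (hX : DSet X) (hx : DPos x) : DSet fun w γ => CircWord.upper (X w γ) (x w γ) :=
  of_dfn ((hx.pop.le DPos.zero).and
    (.ex ((Dfn.mem .zero hX.pop.pop).and (DPos.zero.pop.lt .zero))))

theorem lower (hX : DSet X) (hx : DPos x) : DSet fun w γ => CircWord.lower (X w γ) (x w γ) :=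
  of_dfn ((DPos.zero.lt hx.pop).and
    (.ex ((Dfn.mem .zero hX.pop.pop).and (DPos.le .zero DPos.zero.pop))))

theorem nonempty (hX : DSet X) : Dfn fun w γ => (X w γ).Nonempty := .ex (.mem .zero hX.pop)

theorem eq_empty (hX : DSet X) : Dfn fun w γ => X w γ = ∅ :=
  hX.nonempty.not.congr fun _ _ => Set.not_nonempty_iff_eq_empty

theorem ordConnected (hX : DSet X) : Dfn fun w γ => (X w γ).OrdConnected := by
  have : Dfn fun w γ => ∀ x, x ∈ X w γ → ∀ y, y ∈ X w γ → ∀ z, x ≤ z → z ≤ y → z ∈ X w γ :=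
    .all <| .imp (.mem .zero hX.pop) <| .all <| .imp (.mem .zero hX.pop.pop) <| .all <|
      .imp (DPos.zero.pop.pop.le .zero) <| .imp (DPos.zero.le DPos.zero.pop) <|
        .mem .zero hX.pop.pop.pop
  exact this.congr fun w γ => ⟨fun h => ⟨fun x hx y hy z hz => h x hx y hy z hz.1 hz.2⟩,
    fun h x hx y hy z h₁ h₂ => h.out hx hy ⟨h₁, h₂⟩⟩

end DSet

namespace DCol

variable {Λ Λ' : Type*} {c : ∀ w : LabelledOrder E A, Env w n m → w.Pos → Λ}
  {x : ∀ w : LabelledOrder E A, Env w n m → w.Pos}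

theorem comp {d : ∀ w : LabelledOrder E A, Env w n' m' → Env w n m} (hc : DCol c) (hd : Ren d) :
    DCol fun w γ => c w (d w γ) := fun l => DSet.comp (hc l) hd

theorem pop (hc : DCol c) : DCol fun w (γ : Env w (n + 1) m) => c w γ.pop := hc.comp Ren.pop

theorem popSet (hc : DCol c) : DCol fun w (γ : Env w n (m + 1)) => c w γ.popSet :=
  hc.comp Ren.popSet

theorem eq (hc : DCol c) (hx : DPos x) (l : Λ) : Dfn fun w γ => c w γ (x w γ) = l :=
  Dfn.mem hx (hc l)

/-- A definable relation may depend on the colour of a position. -/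
theorem bind [Finite Λ] {Q : Λ → ∀ w : LabelledOrder E A, Env w n m → Prop} (hc : DCol c)
    (hx : DPos x) (h : ∀ l, Dfn (Q l)) : Dfn fun w γ => Q (c w γ (x w γ)) w γ :=
  (Dfn.exFin fun l => (hc.eq hx l).and (h l)).congr fun _ _ => by simp

theorem map [Finite Λ] (hc : DCol c) (g : Λ → Λ') : DCol fun w γ x => g (c w γ x) := fun l =>
  DSet.of_dfn (hc.pop.bind .zero fun l' => .const (g l' = l))

theorem label : DCol fun (w : LabelledOrder E A) (_ : Env w n m) => w.label := fun a =>
  ⟨.letter a 0, fun _ _ => Iff.rfl⟩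

open Classical in
theorem mask (hc : DCol c) {I : ∀ w : LabelledOrder E A, Env w n m → Set w.Pos} (hI : DSet I)
    (l₀ : Λ) : DCol fun w γ x => if x ∈ I w γ then c w γ x else l₀ := fun l =>
  (((Dfn.mem .zero hI.pop).and (hc.pop.eq .zero l)).or
    ((Dfn.mem .zero hI.pop).not.and (.const (l₀ = l)))).congr fun w γ => by
      change _ ↔ (if γ.1 0 ∈ I w γ.pop then c w γ.pop (γ.1 0) else l₀) = l
      split_ifs with h <;> simp [h]

end DCol

/-- A colour is a vector of `p` bits, one set variable for each. The hypothesis ranges over larger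
environments because these variables are already bound when the colouring is used; `d` recovers the
original environment. -/
theorem Dfn.exCol_prop (p : ℕ) {m : ℕ}
    {Q : ∀ w : LabelledOrder E A, Env w n m → (w.Pos → Fin p → Prop) → Prop}
    (h : ∀ {m'} (d : ∀ w : LabelledOrder E A, Env w n m' → Env w n m)
      (c : ∀ w : LabelledOrder E A, Env w n m' → w.Pos → Fin p → Prop), Ren d → DCol c →
      Dfn fun w γ => Q w (d w γ) (c w γ)) :
    Dfn fun w γ => ∃ c, Q w γ c := by
  induction p generalizing m with
  | zero =>
    refine (h (fun w γ => γ) (fun _ _ _ => Fin.elim0) .id fun l =>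
      .of_dfn (.const (Fin.elim0 = l))).congr fun w γ => ⟨fun h => ⟨_, h⟩, ?_⟩
    rintro ⟨c, hc⟩
    rwa [show c = fun _ => Fin.elim0 from funext fun _ => Subsingleton.elim _ _] at hc
  | succ p ih =>
    have key : Dfn fun w γ => ∃ X : Set w.Pos, ∃ c : w.Pos → Fin p → Prop,
        Q w γ fun x => Fin.cons (x ∈ X) (c x) := by
      refine .exSet (ih (Q := fun w γ c => Q w γ.popSet fun x => Fin.cons (x ∈ γ.2 0) (c x))
        fun d c hd hc => ?_)
      refine h (fun w γ => (d w γ).popSet) (fun w γ x => Fin.cons (x ∈ (d w γ).2 0) (c w γ x))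
        (Ren.popSet.comp hd) fun l => .of_dfn ?_
      refine (((Dfn.mem .zero (DSet.zero.comp hd).pop).iff (.const (l 0))).and
        (hc.pop.eq .zero (Fin.tail l))).congr fun w γ => ?_
      rw [← Fin.cons_self_tail l, Fin.cons_inj, eq_iff_iff]
      simp
    refine key.congr fun w γ => ⟨?_, ?_⟩
    · rintro ⟨X, c, h⟩
      exact ⟨_, h⟩
    · rintro ⟨c, h⟩
      refine ⟨{x | c x 0}, fun x => Fin.tail (c x), ?_⟩
      simpa [Fin.cons_self_tail] using h

/-- Existential quantification over colourings with finitely many colours. -/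
theorem Dfn.exCol {Λ : Type*} [Finite Λ] [Nonempty Λ]
    {Q : ∀ w : LabelledOrder E A, Env w n m → (w.Pos → Λ) → Prop}
    (h : ∀ {m'} (d : ∀ w : LabelledOrder E A, Env w n m' → Env w n m)
      (c : ∀ w : LabelledOrder E A, Env w n m' → w.Pos → Λ), Ren d → DCol c →
      Dfn fun w γ => Q w (d w γ) (c w γ)) :
    Dfn fun w γ => ∃ c, Q w γ c := by
  obtain ⟨p, ⟨e⟩⟩ := Finite.exists_equiv_fin Λ
  -- Decoding by `invFun` turns every choice of sets into a colouring, so the guessed sets need not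
  -- be required to form a partition.
  let code : Λ → Fin p → Prop := fun l i => e l = i
  have hcode : Function.Injective code := fun l l' h => by
    have : e l = e l := rfl
    exact e.injective ((congrFun h (e l)).mp this).symm
  refine (Dfn.exCol_prop p (Q := fun w γ c => Q w γ fun x => Function.invFun code (c x))
    fun d c hd hc => h d _ hd (hc.map _)).congr fun w γ => ⟨?_, ?_⟩
  · rintro ⟨c, hc⟩
    exact ⟨_, hc⟩
  · rintro ⟨c, hc⟩
    refine ⟨fun x => code (c x), ?_⟩
    simpa only [Function.leftInverse_invFun hcode _] using hc

/-- Universal quantification over colourings with finitely many colours. -/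
theorem Dfn.allCol {Λ : Type*} [Finite Λ] [Nonempty Λ]
    {Q : ∀ w : LabelledOrder E A, Env w n m → (w.Pos → Λ) → Prop}
    (h : ∀ {m'} (d : ∀ w : LabelledOrder E A, Env w n m' → Env w n m)
      (c : ∀ w : LabelledOrder E A, Env w n m' → w.Pos → Λ), Ren d → DCol c →
      Dfn fun w γ => Q w (d w γ) (c w γ)) :
    Dfn fun w γ => ∀ c, Q w γ c :=
  (Dfn.exCol (Q := fun w γ c => ¬ Q w γ c) fun d c hd hc => (h d c hd hc).not).not.congr
    fun _ _ => by simp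

end Definability

end CircWord

namespace CircWord

namespace CircSemigroup

/-! ### Evaluation relative to a labelled set of positions -/

section StepRel

variable {E : Prop} {S : Type v} {M : CircSemigroup E S} {α : Type} [LinearOrder α]

/-- The labels of positions that allow to read off the values of the intervals between them. -/
abbrev Label (M : CircSemigroup E S) :=
  Option (WithOne M.Carrier × (WithOne M.Carrier → WithOne M.Carrier))

/-- The value of an interval, computed from the labels of its endpoints. -/
def act (l l' : Label M) : WithOne M.Carrier :=
  match l, l' with
  | some (_, g), some (t, _) => g t
  | _, _ => 1

/-- `s` is the value, computed from the labels, of the interval from `x` to the last point of `Y`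
or the supremum of `Y`. -/
def RightRel (f : α → M.Carrier) (l : α → Label M) (Y : Set α) (x : α)
    (s : WithOne M.Carrier) : Prop :=
  (∃ y, y ∈ Y ∧ (∀ z, z ∈ Y → z ≤ y) ∧
    (y = x ∧ s = f x ∨ x < y ∧ s = act (l x) (l y) * f y)) ∨
  ∃ k, (∀ y, y ∈ Y → ∃ z, z ∈ Y ∧ y < z ∧ l z = k) ∧ s = act (l x) k * omega (act k k)

/-- `s` is the value, computed from the labels, of the interval from the first point of `Y`, or the
infimum of `Y`, to `x`. -/
def LeftRel (l : α → Label M) (Y : Set α) (x : α) (s : WithOne M.Carrier) : Prop :=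
  (∃ y, y ∈ Y ∧ (∀ z, z ∈ Y → y ≤ z) ∧ (y = x ∧ s = 1 ∨ y < x ∧ s = act (l y) (l x))) ∨
  ∃ k, (∀ y, y ∈ Y → ∃ z, z ∈ Y ∧ z < y ∧ l z = k) ∧ s = omegaStar (act k k) * act k (l x)

/-- `s` is the value of `I`, computed from the labels and from values `G` of intervals without
labelled points. -/
def StepRel (f : α → M.Carrier) (l : α → Label M) (G : Set α → WithOne M.Carrier → Prop)
    (I : Set α) (s : WithOne M.Carrier) : Prop :=
  (I ∩ {x | l x ≠ none} = ∅ ∧ G I s) ∨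
  ∃ x, x ∈ I ∩ {x | l x ≠ none} ∧ ∃ t : Fin 4 → WithOne M.Carrier, s = t 0 * t 1 * t 2 * t 3 ∧
    G (I ∩ {z | ∀ y, y ∈ I ∩ {x | l x ≠ none} → z < y}) (t 0) ∧
    LeftRel l (I ∩ {x | l x ≠ none}) x (t 1) ∧ RightRel f l (I ∩ {x | l x ≠ none}) x (t 2) ∧
    G (I ∩ {z | ∀ y, y ∈ I ∩ {x | l x ≠ none} → y < z}) (t 3)

/-- If every colour stopped at some point of `Y`, nothing could lie beyond the largest of these
finitely many points. -/
theorem exists_cofinal_color {κ : Type*} [Finite κ] {Y : Set α} (hY : Y.Nonempty) (l : α → κ)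
    (h : ∀ y ∈ Y, ∃ z ∈ Y, y < z) : ∃ k, ∀ y, y ∈ Y → ∃ z, z ∈ Y ∧ y < z ∧ l z = k := by
  by_contra hno
  push Not at hno
  choose b hb hb' using hno
  obtain ⟨y₀, hy₀⟩ := hY
  have : Nonempty κ := ⟨l y₀⟩
  obtain ⟨k, hk⟩ := Finite.exists_max b
  obtain ⟨z, hz, hlt⟩ := h _ (hb k)
  exact hb' (l z) z hz ((hk _).trans_lt hlt) rfl

theorem exists_coinitial_color {κ : Type*} [Finite κ] {Y : Set α} (hY : Y.Nonempty) (l : α → κ)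
    (h : ∀ y ∈ Y, ∃ z ∈ Y, z < y) : ∃ k, ∀ y, y ∈ Y → ∃ z, z ∈ Y ∧ z < y ∧ l z = k :=
  exists_cofinal_color (α := αᵒᵈ) hY l h

theorem exists_rightRel [Finite S] (f : α → M.Carrier) (l : α → Label M) {Y : Set α}
    {x : α} (hx : x ∈ Y) : ∃ s, RightRel f l Y x s := by
  by_cases hmax : ∃ y ∈ Y, ∀ z ∈ Y, z ≤ y
  · obtain ⟨y, hy, hmax⟩ := hmax
    rcases (hmax x hx).eq_or_lt with h | h
    · exact ⟨_, Or.inl ⟨y, hy, hmax, Or.inl ⟨h.symm, rfl⟩⟩⟩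
    · exact ⟨_, Or.inl ⟨y, hy, hmax, Or.inr ⟨h, rfl⟩⟩⟩
  · push Not at hmax
    obtain ⟨k, hk⟩ := exists_cofinal_color ⟨x, hx⟩ l hmax
    exact ⟨_, Or.inr ⟨k, hk, rfl⟩⟩

theorem exists_leftRel [Finite S] (l : α → Label M) {Y : Set α} {x : α} (hx : x ∈ Y) :
    ∃ s, LeftRel l Y x s := by
  by_cases hmin : ∃ y ∈ Y, ∀ z ∈ Y, y ≤ z
  · obtain ⟨y, hy, hmin⟩ := hmin
    rcases (hmin x hx).eq_or_lt with h | h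
    · exact ⟨_, Or.inl ⟨y, hy, hmin, Or.inl ⟨h, rfl⟩⟩⟩
    · exact ⟨_, Or.inl ⟨y, hy, hmin, Or.inr ⟨h, rfl⟩⟩⟩
  · push Not at hmin
    obtain ⟨k, hk⟩ := exists_coinitial_color ⟨x, hx⟩ l hmin
    exact ⟨_, Or.inr ⟨k, hk, rfl⟩⟩

variable [Countable α] {f : α → M.Carrier} {l : α → Label M} {Y : Set α}

/-- Points that carry a cofinal label `k` have equal factors `act k k` between them, which gives an
`ω`-power. If there is a last point, half-open intervals miss it, whence the extra letter. -/
theorem RightRel.value_eq (hY : ∀ x ∈ Y, ∀ y ∈ Y, x < y → value f (Set.Ico x y) = act (l x) (l y))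
    {x : α} (hx : x ∈ Y) {s : WithOne M.Carrier} (h : RightRel f l Y x s) :
    value f {z | x ≤ z ∧ ∃ y ∈ Y, z ≤ y} = s := by
  rcases h with ⟨y, hy, hmax, ⟨rfl, rfl⟩ | ⟨hxy, rfl⟩⟩ | ⟨k, hk, rfl⟩
  · rw [← value_singleton]
    congr 1
    ext z
    exact ⟨fun ⟨h₁, t, ht, h₂⟩ => le_antisymm (h₂.trans (hmax t ht)) h₁,
      fun h => ⟨(Set.mem_singleton_iff.1 h).ge, y, hy, (Set.mem_singleton_iff.1 h).le⟩⟩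
  · rw [← hY x hx y hy hxy, ← value_singleton, ← value_union f fun s hs t ht => by
      rw [Set.mem_singleton_iff.1 ht]
      exact hs.2]
    congr 1
    ext z
    constructor
    · rintro ⟨h₁, t, ht, h₂⟩
      rcases (h₂.trans (hmax t ht)).eq_or_lt with rfl | h
      · exact Or.inr rfl
      · exact Or.inl ⟨h₁, h⟩
    · rintro (h | h)
      · exact ⟨h.1, y, hy, h.2.le⟩
      · rw [Set.mem_singleton_iff.1 h]
        exact ⟨hxy.le, y, hy, le_rfl⟩
  · obtain ⟨z₀, hz₀, hxz₀, rfl⟩ := hk x hx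
    have hZ := value_upper f (Z := {z | z ∈ Y ∧ l z = l z₀}) (z := z₀) ⟨hz₀, rfl⟩
      (fun y hy => by
        obtain ⟨z, hz, h₁, h₂⟩ := hk y hy.1
        exact ⟨z, ⟨hz, h₂⟩, h₁⟩)
      (e := act (l z₀) (l z₀)) (fun y hy z hz hyz => by rw [hY y hy.1 z hz.1 hyz, hy.2, hz.2])
    rw [← hZ, ← hY x hx _ hz₀ hxz₀, ← value_union f fun s hs t ht => hs.2.trans_le ht.1]
    congr 1
    ext z
    constructor
    · rintro ⟨h₁, t, ht, h₂⟩
      rcases lt_or_ge z z₀ with h | h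
      · exact Or.inl ⟨h₁, h⟩
      · obtain ⟨y, hy, hty, hl⟩ := hk t ht
        exact Or.inr ⟨h, y, ⟨hy, hl⟩, h₂.trans_lt hty⟩
    · rintro (h | ⟨h, y, hy, hzy⟩)
      · exact ⟨h.1, z₀, hz₀, h.2.le⟩
      · exact ⟨hxz₀.le.trans h, y, hy.1, hzy.le⟩

theorem LeftRel.value_eq (hY : ∀ x ∈ Y, ∀ y ∈ Y, x < y → value f (Set.Ico x y) = act (l x) (l y))
    {x : α} (hx : x ∈ Y) {s : WithOne M.Carrier} (h : LeftRel l Y x s) :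
    value f (lower Y x) = s := by
  rcases h with ⟨y, hy, hmin, ⟨rfl, rfl⟩ | ⟨hxy, rfl⟩⟩ | ⟨k, hk, rfl⟩
  · rw [← value_empty f]
    congr 1
    ext z
    exact ⟨fun ⟨h₁, t, ht, h₂⟩ => ((hmin t ht).trans h₂).not_gt h₁, fun h => h.elim⟩
  · rw [← hY y hy x hx hxy]
    congr 1
    ext z
    exact ⟨fun ⟨h₁, t, ht, h₂⟩ => ⟨(hmin t ht).trans h₂, h₁⟩, fun h => ⟨h.2, y, hy, h.1⟩⟩
  · obtain ⟨z₀, hz₀, hxz₀, rfl⟩ := hk x hx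
    have hZ := value_lower f (Z := {z | z ∈ Y ∧ l z = l z₀}) (z := z₀) ⟨hz₀, rfl⟩
      (fun y hy => by
        obtain ⟨z, hz, h₁, h₂⟩ := hk y hy.1
        exact ⟨z, ⟨hz, h₂⟩, h₁⟩)
      (e := act (l z₀) (l z₀)) (fun y hy z hz hyz => by rw [hY y hy.1 z hz.1 hyz, hy.2, hz.2])
    rw [← hZ, ← hY _ hz₀ x hx hxz₀, ← value_union f fun s hs t ht => hs.1.trans_le ht.1]
    congr 1
    ext z
    constructor
    · rintro ⟨h₁, t, ht, h₂⟩
      rcases lt_or_ge z z₀ with h | h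
      · obtain ⟨y, hy, hty, hl⟩ := hk t ht
        exact Or.inl ⟨h, y, ⟨hy, hl⟩, hty.le.trans h₂⟩
      · exact Or.inr ⟨h, h₁⟩
    · rintro (⟨h, y, hy, hzy⟩ | h)
      · exact ⟨h.trans hxz₀, y, hy.1, hzy⟩
      · exact ⟨h.2, z₀, hz₀, h.1⟩

/-- A labelled point `x` cuts `I` into four factors: below all labelled points, from there to `x`,
from `x` to the end of the labelled points, and above them. The outer factors carry no labels and
are left to `G`; the inner ones are computed from the labels. -/
theorem stepRel_iff [Finite S] {G : Set α → WithOne M.Carrier → Prop} {I : Set α}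
    (hI : I.OrdConnected)
    (hl : ∀ x ∈ I, ∀ y ∈ I, l x ≠ none → l y ≠ none → x < y →
      value f (Set.Ico x y) = act (l x) (l y))
    (hG : ∀ J ⊆ I, J.OrdConnected → (∀ x ∈ J, l x = none) → ∀ s, G J s ↔ value f J = s)
    (s : WithOne M.Carrier) : StepRel f l G I s ↔ value f I = s := by
  set Y := I ∩ {x | l x ≠ none} with hYdef
  have hY : ∀ x ∈ Y, ∀ y ∈ Y, x < y → value f (Set.Ico x y) = act (l x) (l y) :=
    fun x hx y hy => hl x hx.1 y hy.1 hx.2 hy.2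
  have hGbelow := hG (I ∩ {z | ∀ y, y ∈ Y → z < y}) Set.inter_subset_left
    (hI.inter ⟨fun a ha b hb t ht y hy => ht.2.trans_lt (hb y hy)⟩)
    (fun x hx => by_contra fun h => (hx.2 x ⟨hx.1, h⟩).false)
  have hGabove := hG (I ∩ {z | ∀ y, y ∈ Y → y < z}) Set.inter_subset_left
    (hI.inter ⟨fun a ha b hb t ht y hy => (ha y hy).trans_le ht.1⟩)
    (fun x hx => by_contra fun h => (hx.2 x ⟨hx.1, h⟩).false)
  have hsplit : ∀ x ∈ Y, value f I = value f (I ∩ {z | ∀ y, y ∈ Y → z < y}) *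
      value f (lower Y x) * value f {z | x ≤ z ∧ ∃ y ∈ Y, z ≤ y} *
      value f (I ∩ {z | ∀ y, y ∈ Y → y < z}) := by
    intro x hx
    have h₁ : ∀ a ∈ I ∩ {z | ∀ y, y ∈ Y → z < y}, ∀ b ∈ lower Y x, a < b := by
      rintro a ⟨-, ha⟩ b ⟨-, y, hy, hb⟩
      exact (ha y hy).trans_le hb
    have h₂ : ∀ a ∈ (I ∩ {z | ∀ y, y ∈ Y → z < y}) ∪ lower Y x,
        ∀ b ∈ {z | x ≤ z ∧ ∃ y ∈ Y, z ≤ y}, a < b := by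
      rintro a (⟨-, ha⟩ | ha) b ⟨hb, -⟩
      · exact (ha x hx).trans_le hb
      · exact ha.1.trans_le hb
    have h₃ : ∀ a ∈ (I ∩ {z | ∀ y, y ∈ Y → z < y}) ∪ lower Y x ∪ {z | x ≤ z ∧ ∃ y ∈ Y, z ≤ y},
        ∀ b ∈ I ∩ {z | ∀ y, y ∈ Y → y < z}, a < b := by
      rintro a ((⟨-, ha⟩ | ha) | ⟨-, y, hy, ha⟩) b ⟨-, hb⟩
      · exact (ha x hx).trans (hb x hx)
      · exact ha.1.trans (hb x hx)
      · exact ha.trans_lt (hb y hy)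
    rw [← value_union f h₁, ← value_union f h₂, ← value_union f h₃]
    congr 1
    ext z
    constructor
    · intro hz
      by_cases hb : ∀ y, y ∈ Y → z < y
      · exact Or.inl (Or.inl (Or.inl ⟨hz, hb⟩))
      by_cases ha : ∀ y, y ∈ Y → y < z
      · exact Or.inr ⟨hz, ha⟩
      push Not at ha hb
      obtain ⟨y, hy, hyz⟩ := hb
      obtain ⟨y', hy', hyz'⟩ := ha
      rcases lt_or_ge z x with h | h
      · exact Or.inl (Or.inl (Or.inr ⟨h, y, hy, hyz⟩))
      · exact Or.inl (Or.inr ⟨h, y', hy', hyz'⟩)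
    · rintro (((h | ⟨h, y, hy, hz⟩) | ⟨h, y, hy, hz⟩) | h)
      · exact h.1
      · exact hI.out hy.1 hx.1 ⟨hz, h.le⟩
      · exact hI.out hx.1 hy.1 ⟨h, hz⟩
      · exact h.1
  have hnone : Y = ∅ → ∀ x ∈ I, l x = none := fun h x hx => by
    by_contra hne
    have : x ∈ Y := ⟨hx, hne⟩
    rw [h] at this
    exact this
  constructor
  · rintro (⟨h, hs⟩ | ⟨x, hx, t, rfl, h₀, h₁, h₂, h₃⟩)
    · exact (hG I subset_rfl hI (hnone h) s).1 hs
    · rw [hsplit x hx, (hGbelow _).1 h₀, (hGabove _).1 h₃, h₁.value_eq hY hx, h₂.value_eq hY hx]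
  · rintro rfl
    rcases Y.eq_empty_or_nonempty with h | ⟨x, hx⟩
    · exact Or.inl ⟨h, (hG I subset_rfl hI (hnone h) _).2 rfl⟩
    · obtain ⟨t₁, h₁⟩ := exists_leftRel l hx
      obtain ⟨t₂, h₂⟩ := exists_rightRel f l hx
      refine Or.inr ⟨x, hx, ![value f (I ∩ {z | ∀ y, y ∈ Y → z < y}), t₁, t₂,
        value f (I ∩ {z | ∀ y, y ∈ Y → y < z})], ?_, (hGbelow _).2 rfl, h₁, h₂, (hGabove _).2 rfl⟩
      rw [hsplit x hx, h₁.value_eq hY hx, h₂.value_eq hY hx]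
      rfl

end StepRel

/-! ### Existence of labels -/

section Label

variable {E : Prop} {S : Type v} [Finite S] {M : CircSemigroup E S} {α : Type} [LinearOrder α]
  [Countable α] (f : α → M.Carrier)

theorem rank_value_Ico_le_left {x y z : α} (hxy : x ≤ y) (hyz : y ≤ z) :
    rank (value f (Set.Ico x z)) ≤ rank (value f (Set.Ico x y)) := by
  rw [← value_Ico_mul f hxy hyz]
  exact rank_mul_le_left _ _

theorem rank_value_Ico_le_right {x y z : α} (hxy : x ≤ y) (hyz : y ≤ z) :
    rank (value f (Set.Ico x z)) ≤ rank (value f (Set.Ico y z)) := by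
  rw [← value_Ico_mul f hxy hyz]
  exact rank_mul_le_right _ _

/-- The colour of `y` is the limit, along an ultrafilter on `X` tending downwards, of the values of
`[z, y)`. If `y` and `y'` have the same colour, then `[z, y)` and `[z, y')` have equal values for
some `z ≤ x` in `X`, and the common left factor `[z, x)` can be cancelled since no rank drops. -/
theorem exists_color_of_rank_eq {X : Set α} {k : ℕ}
    (hX : ∀ x ∈ X, ∀ y ∈ X, x < y → rank (value f (Set.Ico x y)) = k) :
    ∃ c : α → WithOne M.Carrier, ∀ x ∈ X, ∀ y ∈ X, ∀ y' ∈ X, x < y → x < y' → c y = c y' →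
      value f (Set.Ico x y) = value f (Set.Ico x y') := by
  rcases X.eq_empty_or_nonempty with rfl | hne
  · exact ⟨fun _ => 1, by simp⟩
  have := hne.to_subtype
  let U : Ultrafilter X := Ultrafilter.of Filter.atBot
  have hlim : ∀ y : α, ∃ s, ∀ᶠ z in (U : Filter X), value f (Set.Ico z.1 y) = s := fun y =>
    Ultrafilter.eventually_exists_iff.1 (Filter.Eventually.of_forall fun z => ⟨_, rfl⟩)
  choose c hc using hlim
  refine ⟨c, fun x hx y hy y' hy' hxy hxy' hcc => ?_⟩
  have hle : ∀ᶠ z in (U : Filter X), z ≤ ⟨x, hx⟩ :=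
    Ultrafilter.of_le _ (Filter.eventually_le_atBot _)
  obtain ⟨z, hzx, hzy, hzy'⟩ := (hle.and ((hc y).and (hc y'))).exists
  replace hzx : z.1 ≤ x := hzx
  rw [hcc, ← hzy'] at hzy
  rcases hzx.eq_or_lt with rfl | hzx'
  · exact hzy
  wlog hyy : y ≤ y' generalizing y y'
  · exact (this y' hy' y hy hxy' hxy hcc.symm hzy.symm (by rw [hzy, hzy', hcc])
      (le_of_not_ge hyy)).symm
  rw [← value_Ico_mul f hzx hxy.le, ← value_Ico_mul f hzx hxy'.le] at hzy
  obtain ⟨u, hu⟩ := exists_left_inverse_of_rank_eq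
    (a := value f (Set.Ico z.1 x)) (s := value f (Set.Ico x y)) (by
      rw [value_Ico_mul f hzx hxy.le, hX _ z.2 _ hy (hzx.trans_lt hxy), hX _ hx _ hy hxy])
  calc value f (Set.Ico x y)
      = u * (value f (Set.Ico z.1 x) * value f (Set.Ico x y)) := hu
    _ = u * (value f (Set.Ico z.1 x) * value f (Set.Ico x y')) := by rw [hzy]
    _ = u * (value f (Set.Ico z.1 x) * value f (Set.Ico x y)) * value f (Set.Ico y y') := by
      rw [← value_Ico_mul f hxy.le hyy]
      simp only [mul_assoc]
    _ = value f (Set.Ico x y') := by rw [← hu, value_Ico_mul f hxy.le hyy]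

/-- For fixed `x` the value of `[x, y)` depends only on the colour of `y`. The label of a point
pairs its own colour with this dependence. -/
theorem exists_label_of_rank_eq {X : Set α} {k : ℕ}
    (hX : ∀ x ∈ X, ∀ y ∈ X, x < y → rank (value f (Set.Ico x y)) = k) :
    ∃ l : α → Label M, (∀ x, l x ≠ none ↔ x ∈ X) ∧
      ∀ x ∈ X, ∀ y ∈ X, x < y → value f (Set.Ico x y) = act (l x) (l y) := by
  classical
  obtain ⟨c, hc⟩ := exists_color_of_rank_eq f hX
  have hg : ∀ x ∈ X, ∀ t, ∃ s, ∀ y ∈ X, x < y → c y = t → value f (Set.Ico x y) = s := by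
    intro x hx t
    by_cases h : ∃ y ∈ X, x < y ∧ c y = t
    · obtain ⟨y, hy, hxy, rfl⟩ := h
      exact ⟨_, fun y' hy' hxy' hcy => hc x hx y' hy' y hy hxy' hxy hcy⟩
    · push Not at h
      exact ⟨1, fun y hy hxy hcy => (h y hy hxy hcy).elim⟩
  choose! g hg using hg
  refine ⟨fun x => if x ∈ X then some (c x, g x) else none, fun x => by simp, ?_⟩
  intro x hx y hy hxy
  simp only [hx, hy, if_true, act]
  exact hg x hx _ y hy hxy rfl

/-- Inside an interval whose factors have rank at least `k` one can choose points such that the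
factors between them have rank `k`, and such that the gaps between these points are cut into two
parts (outside and inside the set `D`) whose factors have larger rank. -/
theorem exists_maximal_of_le_rank {C : Set α} {k : ℕ}
    (hk : ∀ x ∈ C, ∀ y ∈ C, x < y → k ≤ rank (value f (Set.Ico x y))) :
    ∃ X ⊆ C, ∃ D : Set α, (∀ x ∈ X, ∀ y ∈ X, x < y → rank (value f (Set.Ico x y)) = k) ∧
      (∀ x ∈ C, ∀ y ∈ C, x ≤ y → (∀ z ∈ Set.Icc x y, z ∉ X) → x ∈ D → y ∈ D) ∧
      ∀ x ∈ C, ∀ y ∈ C, x < y → (∀ z ∈ Set.Icc x y, z ∉ X) → (x ∈ D ↔ y ∈ D) →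
        k + 1 ≤ rank (value f (Set.Ico x y)) := by
  obtain ⟨X, hX⟩ := zorn_subset
    {X : Set α | X ⊆ C ∧ ∀ x ∈ X, ∀ y ∈ X, x < y → rank (value f (Set.Ico x y)) ≤ k} (by
      intro c hc hchain
      refine ⟨⋃₀ c, ⟨Set.sUnion_subset fun Y hY => (hc hY).1, ?_⟩,
        fun Y hY => Set.subset_sUnion_of_mem hY⟩
      rintro x ⟨Y, hY, hx⟩ y ⟨Z, hZ, hy⟩ hxy
      rcases hchain.total hY hZ with h | h
      · exact (hc hZ).2 x (h hx) y hy hxy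
      · exact (hc hY).2 x hx y (h hy) hxy)
  obtain ⟨⟨hXC, hXk⟩, hmax⟩ := hX
  -- `D` consists of the points at which a factor of rank at most `k` ends that starts in the same
  -- gap. So between two points of a gap outside `D` the rank exceeds `k`.
  refine ⟨X, hXC, {y | ∃ x ∈ C, x < y ∧ (∀ z ∈ Set.Icc x y, z ∉ X) ∧
    rank (value f (Set.Ico x y)) ≤ k}, fun x hx y hy hxy =>
      le_antisymm (hXk x hx y hy hxy) (hk x (hXC hx) y (hXC hy) hxy), ?_, ?_⟩
  · rintro x hx y hy hxy hno ⟨t, ht, htx, hno', hr⟩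
    refine ⟨t, ht, htx.trans_le hxy, fun z hz => ?_,
      (rank_value_Ico_le_left f htx.le hxy).trans hr⟩
    rcases le_total z x with h | h
    · exact hno' z ⟨hz.1, h⟩
    · exact hno z ⟨h, hz.2⟩
  · intro x hx y hy hxy hno hD
    by_contra hr
    have hr' : rank (value f (Set.Ico x y)) ≤ k := by omega
    obtain ⟨t, ht, htx, hno', hrt⟩ := hD.2 ⟨x, hx, hxy, hno, hr'⟩
    -- Both points lie in `D` and the rank between them is at most `k`. Then `x` could be added to
    -- `X`: a factor from `X` up to `x` contains `[t, x)`, a factor from `x` to a later point of `X`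
    -- contains `[x, y)`, and larger factors have no larger rank.
    refine hno x ⟨le_rfl, hxy.le⟩ (hmax (y := insert x X) ⟨Set.insert_subset hx hXC, ?_⟩
      (Set.subset_insert x X) (Set.mem_insert x X))
    have hlow : ∀ p ∈ X, p < x → rank (value f (Set.Ico p x)) ≤ k := fun p hp hpx => by
      have hpt : p ≤ t := le_of_not_ge fun h => hno' p ⟨h, hpx.le⟩ hp
      exact (rank_value_Ico_le_right f hpt htx.le).trans hrt
    have hhigh : ∀ p ∈ X, x < p → rank (value f (Set.Ico x p)) ≤ k := fun p hp hpx => by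
      have hpy : y ≤ p := le_of_not_ge fun h => hno p ⟨hpx.le, h⟩ hp
      exact (rank_value_Ico_le_left f hxy.le hpy).trans hr'
    rintro p (rfl | hp) q (rfl | hq) hpq
    · exact (hpq.false).elim
    · exact hhigh q hq hpq
    · exact hlow p hp hpq
    · exact hXk p hp q hq hpq

end Label

end CircSemigroup

end CircWord

namespace CircWord

namespace CircSemigroup

/-! ### Evaluation relative to a colouring is definable -/

section

variable {E : Prop} {A : Type u} {S : Type v} [Finite S] {M : CircSemigroup E S}
  {n m : ℕ} {l : ∀ w : LabelledOrder E A, Env w n m → w.Pos → Label M}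
  {I : ∀ w : LabelledOrder E A, Env w n m → Set w.Pos}
  {x : ∀ w : LabelledOrder E A, Env w n m → w.Pos} (a : A → M.Carrier)

theorem dfn_rightRel [Finite A] (hl : DCol l) (hI : DSet I) (hx : DPos x) (s : WithOne M.Carrier) :
    Dfn fun w γ => RightRel (fun z => a (w.label z)) (l w γ) (I w γ) (x w γ) s := by
  refine .or (.ex <| .and (.mem .zero hI.pop) <| .and
    (.all <| .imp (.mem .zero hI.pop.pop) (DPos.zero.le DPos.zero.pop)) ?_)
    (.exFin fun k => .and (.all <| .imp (.mem .zero hI.pop) <| .ex <| .and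
      (.mem .zero hI.pop.pop) <| .and (DPos.zero.pop.lt .zero) (hl.pop.pop.eq .zero k)) ?_)
  · refine .or (.and (DPos.zero.eq hx.pop) ?_) (.and (hx.pop.lt .zero) ?_)
    · exact DCol.label.bind hx.pop fun b => .const (s = a b)
    · exact hl.pop.bind hx.pop fun k => hl.pop.bind .zero fun k' => DCol.label.bind .zero fun b =>
        .const (s = act k k' * a b)
  · exact hl.bind hx fun j => .const (s = act j k * omega (act k k))

theorem dfn_leftRel (hl : DCol l) (hI : DSet I) (hx : DPos x) (s : WithOne M.Carrier) :
    Dfn fun w γ => LeftRel (l w γ) (I w γ) (x w γ) s := by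
  refine .or (.ex <| .and (.mem .zero hI.pop) <| .and
    (.all <| .imp (.mem .zero hI.pop.pop) (DPos.zero.pop.le .zero)) ?_)
    (.exFin fun k => .and (.all <| .imp (.mem .zero hI.pop) <| .ex <| .and
      (.mem .zero hI.pop.pop) <| .and (DPos.zero.lt DPos.zero.pop) (hl.pop.pop.eq .zero k)) ?_)
  · refine .or (.and (DPos.zero.eq hx.pop) (.const _)) (.and (DPos.zero.lt hx.pop) ?_)
    exact hl.pop.bind .zero fun k => hl.pop.bind hx.pop fun k' => .const (s = act k k')
  · exact hl.bind hx fun j => .const (s = omegaStar (act k k) * act k j)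

/-- A relation `R` that depends on a colouring, a set of positions and a value is definable. -/
def DRel {Λ : Type*} {T : Type*}
    (R : ∀ w : LabelledOrder E A, (w.Pos → Λ) → Set w.Pos → T → Prop) : Prop :=
  ∀ {n m : ℕ} (c : ∀ w : LabelledOrder E A, Env w n m → w.Pos → Λ)
    (I : ∀ w : LabelledOrder E A, Env w n m → Set w.Pos) (s : T), DCol c → DSet I →
    Dfn fun w γ => R w (c w γ) (I w γ) s

/-- The product of the values, according to `R`, of the parts of an interval outside and inside
the set `D`. -/
def GapRel {α T : Type*} [Mul T] (D : Set α) (R : Set α → T → Prop) (I : Set α) (s : T) : Prop :=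
  ∃ t : T × T, s = t.1 * t.2 ∧ R (I ∩ {x | x ∉ D}) t.1 ∧ R (I ∩ D) t.2

theorem dfn_stepRel [Finite A] {Λ : Type*} {c : ∀ w : LabelledOrder E A, Env w n m → w.Pos → Λ}
    {D : ∀ w : LabelledOrder E A, Env w n m → Set w.Pos}
    {R : ∀ w : LabelledOrder E A, (w.Pos → Λ) → Set w.Pos → WithOne M.Carrier → Prop}
    (hR : DRel R) (hl : DCol l) (hc : DCol c) (hD : DSet D) (hI : DSet I)
    (s : WithOne M.Carrier) :
    Dfn fun w γ => StepRel (fun z => a (w.label z)) (l w γ)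
      (GapRel (D w γ) (R w (c w γ))) (I w γ) s := by
  have hY : DSet fun w γ => I w γ ∩ {x | l w γ x ≠ none} :=
    hI.inter (.of_dfn (hl.pop.eq .zero none).not)
  refine .or (.and hY.eq_empty (.exFin fun t => .and (.const _) <| .and
    (hR _ _ _ hc (hI.inter (.of_dfn (Dfn.mem .zero hD.pop).not))) (hR _ _ _ hc (hI.inter hD))))
    (.ex <| .and (.mem .zero hY.pop) <| .exFin fun t => .and (.const _) <| .and
      (.exFin fun t => .and (.const _) (.and (hR _ _ _ hc.pop ?_) (hR _ _ _ hc.pop ?_))) <| .and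
      (dfn_leftRel hl.pop hY.pop .zero _) <| .and (dfn_rightRel a hl.pop hY.pop .zero _) <|
      (.exFin fun t => .and (.const _) (.and (hR _ _ _ hc.pop ?_) (hR _ _ _ hc.pop ?_))))
  · exact (hI.pop.inter (.of_dfn <| .all <| .imp (.mem .zero hY.pop.pop.pop)
      (DPos.zero.pop.lt .zero))).inter (.of_dfn (Dfn.mem .zero hD.pop.pop).not)
  · exact (hI.pop.inter (.of_dfn <| .all <| .imp (.mem .zero hY.pop.pop.pop)
      (DPos.zero.pop.lt .zero))).inter hD.pop
  · exact (hI.pop.inter (.of_dfn <| .all <| .imp (.mem .zero hY.pop.pop.pop)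
      (DPos.zero.lt DPos.zero.pop))).inter (.of_dfn (Dfn.mem .zero hD.pop.pop).not)
  · exact (hI.pop.inter (.of_dfn <| .all <| .imp (.mem .zero hY.pop.pop.pop)
      (DPos.zero.lt DPos.zero.pop))).inter hD.pop

end

/-! ### Downward induction on the rank -/

section

variable {E : Prop} {A : Type u} {S : Type v} {M : CircSemigroup E S}

/-- On intervals whose factors have rank at least `k`, evaluation is definable relative to a
suitable colouring of the positions, uniformly in the word. -/
def EvalDefinable (a : A → M.Carrier) (k : ℕ) : Prop :=
  ∃ (Λ : Type v) (_ : Finite Λ) (_ : Nonempty Λ)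
    (R : ∀ w : LabelledOrder E A, (w.Pos → Λ) → Set w.Pos → WithOne M.Carrier → Prop),
    -- Locality allows colourings found separately on disjoint pieces to be glued.
    DRel R ∧ (∀ w c c' I s, (∀ x ∈ I, c x = c' x) → (R w c I s ↔ R w c' I s)) ∧
    ∀ (w : LabelledOrder E A) (C : Set w.Pos), C.OrdConnected →
      (∀ x ∈ C, ∀ y ∈ C, x < y → k ≤ rank (value (fun z => a (w.label z)) (Set.Ico x y))) →
      ∃ c, ∀ I ⊆ C, I.OrdConnected → ∀ s, R w c I s ↔ value (fun z => a (w.label z)) I = s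

variable [Finite A] [Finite S] (a : A → M.Carrier)

/-- No rank reaches `k`, so `C` has at most one point. -/
theorem evalDefinable_of_card_lt {k : ℕ} (hk : Nat.card (WithOne M.Carrier) < k) :
    EvalDefinable (E := E) a k := by
  refine ⟨PUnit, inferInstance, inferInstance, fun w _ I s =>
    (I = ∅ ∧ s = 1) ∨ ∃ x, x ∈ I ∧ s = a (w.label x), fun c I s _ hI => ?_,
    fun _ _ _ _ _ _ => Iff.rfl, fun w C hC hr => ⟨fun _ => PUnit.unit, fun I hI _ s => ?_⟩⟩
  · exact .or (.and hI.eq_empty (.const _)) (.ex <| .and (.mem .zero hI.pop) <|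
      DCol.label.bind .zero fun b => .const (s = a b))
  · have hsub : ∀ x ∈ I, I = {x} := fun x hx => by
      ext y
      refine ⟨fun hy => ?_, fun hy => (Set.mem_singleton_iff.1 hy).symm ▸ hx⟩
      by_contra hne
      rcases lt_or_gt_of_ne hne with h | h
      · exact absurd (hr y (hI hy) x (hI hx) h) (not_le.2 ((rank_le_card _).trans_lt hk))
      · exact absurd (hr x (hI hx) y (hI hy) h) (not_le.2 ((rank_le_card _).trans_lt hk))
    constructor
    · rintro (⟨rfl, rfl⟩ | ⟨x, hx, rfl⟩)
      · simp
      · rw [hsub x hx, value_singleton]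
    · rintro rfl
      rcases I.eq_empty_or_nonempty with rfl | ⟨x, hx⟩
      · simp
      · exact Or.inr ⟨x, hx, by rw [hsub x hx, value_singleton]⟩

theorem block_ordConnected {α κ : Type*} [LinearOrder α] (c : α → κ) {C : Set α}
    (hC : C.OrdConnected) (x : α) : (block c C x).OrdConnected :=
  ⟨fun y hy z hz t ht => ⟨hC.out hy.1 hz.1 ht, fun s hs => by
    rcases hs with hs | hs
    · exact hz.2 s (Or.inl ⟨hs.1, hs.2.trans ht.2⟩)
    · exact hy.2 s (Or.inr ⟨ht.1.trans hs.1, hs.2⟩)⟩⟩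

theorem block_eq_of_mem {α κ : Type*} [LinearOrder α] (c : α → κ) {C : Set α} {x y : α}
    (hx : x ∈ C) (hy : y ∈ block c C x) : block c C y = block c C x := by
  have heq := block_equivalence c C
  ext z
  exact ⟨fun hz => heq.trans (x := ⟨x, hx⟩) (y := ⟨y, hy.1⟩) (z := ⟨z, hz.1⟩) hy hz,
    fun hz => heq.trans (x := ⟨y, hy.1⟩) (y := ⟨x, hx⟩) (z := ⟨z, hz.1⟩)
      (heq.symm (x := ⟨x, hx⟩) (y := ⟨y, hy.1⟩) hy) hz⟩

/-- The new colour of a point records its label if it lies in the maximal set `X`, its membership in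
`D`, and its colour in the solution for `k + 1` on its own piece of a gap. -/
theorem EvalDefinable.of_succ {k : ℕ} (h : EvalDefinable (E := E) a (k + 1)) :
    EvalDefinable (E := E) a k := by
  classical
  obtain ⟨Λ, hfin, ⟨l₀⟩, R, hR, hloc, hcorrect⟩ := h
  -- Colours outside `I` are replaced by a default, which makes the new relation local.
  let d : (w : LabelledOrder E A) → (w.Pos → Label M × Bool × Λ) → Set w.Pos → w.Pos →
    Label M × Bool × Λ := fun w c I x => if x ∈ I then c x else (none, false, l₀)
  refine ⟨Label M × Bool × Λ, inferInstance, ⟨(none, false, l₀)⟩, fun w c I s =>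
    StepRel (fun z => a (w.label z)) (fun x => (d w c I x).1)
      (GapRel {x | (d w c I x).2.1 = true} (R w fun x => (d w c I x).2.2)) I s,
    fun c I s hc hI => ?_, fun w c c' I s hcc => ?_, fun w C hC hr => ?_⟩
  · have hd := hc.mask hI (none, false, l₀)
    exact dfn_stepRel a hR (hd.map Prod.fst) (hd.map fun x => x.2.2) (hd.map (fun x => x.2.1) true)
      hI s
  · have : d w c I = d w c' I := by
      funext x
      simp only [d]
      split_ifs with hx
      · exact hcc x hx
      · rfl
    simp only [this]
  set f : w.Pos → M.Carrier := fun z => a (w.label z) with hf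
  obtain ⟨X, hXC, D, hXk, hDup, hgap⟩ := exists_maximal_of_le_rank f hr
  obtain ⟨l, hlX, hl⟩ := exists_label_of_rank_eq f hXk
  -- Outside `X`, the blocks of this colouring are the two parts of each gap, on which all ranks are
  -- at least `k + 1`.
  let col : w.Pos → Prop × Prop := fun x => (x ∈ X, x ∈ D)
  have hpiece : ∀ x ∈ C, x ∉ X → ∃ c, ∀ I ⊆ block col C x, I.OrdConnected →
      ∀ s, R w c I s ↔ value f I = s := fun x hx hxX => by
    refine hcorrect w _ (block_ordConnected col hC x) fun y hy z hz hyz => ?_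
    have hcol : ∀ t ∈ Set.Icc y z, col t = col x := fun t ht =>
      ((block_ordConnected col hC x).out hy hz ht).2 t
        ((le_total x t).imp (fun h => ⟨h, le_rfl⟩) fun h => ⟨le_rfl, h⟩)
    refine hgap y hy.1 z hz.1 hyz (fun t ht htX => hxX ?_) ?_
    · have := congrArg Prod.fst (hcol t ht)
      exact this.mp htX
    · have h₁ := congrArg Prod.snd (hcol y ⟨le_rfl, hyz.le⟩)
      have h₂ := congrArg Prod.snd (hcol z ⟨hyz.le, le_rfl⟩)
      exact iff_of_eq (h₁.trans h₂.symm)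
  -- The colouring is chosen as a function of the block, so that all points of one block use the
  -- same choice.
  let G : Set w.Pos → w.Pos → Λ := fun B =>
    if h : ∃ c, ∀ I ⊆ B, I.OrdConnected → ∀ s, R w c I s ↔ value f I = s then h.choose
    else fun _ => l₀
  have hG : ∀ x ∈ C, x ∉ X → ∀ I ⊆ block col C x, I.OrdConnected →
      ∀ s, R w (G (block col C x)) I s ↔ value f I = s := fun x hx hxX => by
    have h := hpiece x hx hxX
    simp only [G, dif_pos h]
    exact h.choose_spec
  let c : w.Pos → Label M × Bool × Λ := fun x => (l x, decide (x ∈ D), G (block col C x) x)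
  refine ⟨c, fun I hIC hI s => ?_⟩
  have hdI : ∀ x ∈ I, d w c I x = c x := fun x hx => if_pos hx
  refine stepRel_iff hI (fun x hx y hy hlx hly hxy => ?_) (fun J hJI hJ hJX s => ?_) s
  · rw [hdI x hx] at hlx ⊢
    rw [hdI y hy] at hly ⊢
    exact hl x ((hlX x).1 hlx) y ((hlX y).1 hly) hxy
  have hJX' : ∀ x ∈ J, x ∉ X := fun x hx hxX => by
    have := hJX x hx
    rw [hdI x (hJI hx)] at this
    exact (hlX x).2 hxX this
  have hDeq : J ∩ {x | (d w c I x).2.1 = true} = J ∩ D := by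
    ext x
    refine and_congr_right fun hx => ?_
    change (d w c I x).2.1 = true ↔ x ∈ D
    rw [hdI x (hJI hx)]
    simp [c]
  have hDeq' : J ∩ {x | x ∉ {x | (d w c I x).2.1 = true}} = J ∩ Dᶜ := by
    ext x
    refine and_congr_right fun hx => ?_
    change ¬ (d w c I x).2.1 = true ↔ x ∉ D
    rw [hdI x (hJI hx)]
    simp [c]
  have hup : ∀ x ∈ J, ∀ y ∈ J, x ≤ y → x ∈ D → y ∈ D := fun x hx y hy hxy =>
    hDup x (hIC (hJI hx)) y (hIC (hJI hy)) hxy fun z hz => hJX' z (hJ.out hx hy hz)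
  -- `D` is upward closed within a gap, so the part outside `D` comes first in the product.
  have hlt : ∀ x ∈ J ∩ Dᶜ, ∀ y ∈ J ∩ D, x < y := fun x hx y hy =>
    lt_of_not_ge fun h => hx.2 (hup y hy.1 x hx.1 h hy.2)
  have hval : value f J = value f (J ∩ Dᶜ) * value f (J ∩ D) := by
    rw [← value_union f hlt, ← Set.inter_union_distrib_left, Set.compl_union_self, Set.inter_univ]
  have hpart : ∀ K ⊆ J, K.OrdConnected → (∀ x ∈ K, ∀ y ∈ K, x ∈ D ↔ y ∈ D) →
      ∀ s, R w (fun x => (d w c I x).2.2) K s ↔ value f K = s := by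
    intro K hKJ hK hKD s
    rcases K.eq_empty_or_nonempty with rfl | ⟨x, hx⟩
    · obtain ⟨c', hc'⟩ := hcorrect w ∅ Set.ordConnected_empty (by simp)
      rw [← hc' ∅ subset_rfl Set.ordConnected_empty s]
      exact hloc _ _ _ _ _ (by simp)
    have hxC := hIC (hJI (hKJ hx))
    have hKb : K ⊆ block col C x := fun y hy => ⟨hIC (hJI (hKJ hy)), fun z hz => by
      have hzK : z ∈ K := hz.elim (fun h => hK.out hx hy h) fun h => hK.out hy hx h
      exact Prod.ext (propext (iff_of_false (hJX' z (hKJ hzK)) (hJX' x (hKJ hx))))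
        (propext (hKD z hzK x hx))⟩
    rw [← hG x hxC (hJX' x (hKJ hx)) K hKb hK s]
    refine hloc _ _ _ _ _ fun y hy => ?_
    rw [hdI y (hJI (hKJ hy))]
    simp only [c, block_eq_of_mem col hxC (hKb hy)]
  have h₁ := hpart (J ∩ Dᶜ) Set.inter_subset_left
    ⟨fun x hx y hy z hz => ⟨hJ.out hx.1 hy.1 hz, fun hzD =>
      hy.2 (hup z (hJ.out hx.1 hy.1 hz) y hy.1 hz.2 hzD)⟩⟩
    (fun x hx y hy => iff_of_false hx.2 hy.2)
  have h₂ := hpart (J ∩ D) Set.inter_subset_left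
    ⟨fun x hx y hy z hz => ⟨hJ.out hx.1 hy.1 hz,
      hup x hx.1 z (hJ.out hx.1 hy.1 hz) hz.1 hx.2⟩⟩
    (fun x hx y hy => iff_of_true hx.2 hy.2)
  rw [GapRel, hDeq, hDeq', hval]
  constructor
  · rintro ⟨t, rfl, ht₁, ht₂⟩
    rw [(h₁ _).1 ht₁, (h₂ _).1 ht₂]
  · rintro rfl
    exact ⟨(value f (J ∩ Dᶜ), value f (J ∩ D)), rfl, (h₁ _).2 rfl, (h₂ _).2 rfl⟩

theorem evalDefinable (k : ℕ) : EvalDefinable (E := E) a k := by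
  have h : ∀ j k, Nat.card (WithOne M.Carrier) < k + j → EvalDefinable (E := E) a k := by
    intro j
    induction j with
    | zero => exact fun k hk => evalDefinable_of_card_lt a hk
    | succ j ih => exact fun k hk => (ih (k + 1) (by omega)).of_succ
  exact h (Nat.card (WithOne M.Carrier) + 1) k (by omega)

end

end CircSemigroup

end CircWord

namespace CircWord

namespace CircSemigroup

/-! ### Evaluation is definable -/

section

variable {E : Prop} {A : Type u} {S : Type v} {M : CircSemigroup E S}

/-- Every set in the closure conditions is convex, so closure is inherited from the relation of
having the true value. -/
theorem isClosedRel_of_iff {α : Type} [LinearOrder α] [Countable α] {f : α → M.Carrier}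
    {R : Set α → WithOne M.Carrier → Prop}
    (h : ∀ I : Set α, I.OrdConnected → ∀ s, R I s ↔ value f I = s) : IsClosedRel f R := by
  have hv := isClosedRel_value f
  constructor
  · exact fun x => (h _ Set.ordConnected_singleton _).2 (hv.singleton x)
  · intro I J hI hJ hIc hJc hIJ hlt s t hs ht
    exact (h _ hIJ _).2 (hv.union I J hI hJ hIc hJc hIJ hlt s t ((h _ hIc _).1 hs)
      ((h _ hJc _).1 ht))
  · intro Z z hz hmax e he
    exact (h _ (upper_ordConnected Z z) _).2 (hv.upper Z z hz hmax e fun x hx y hy hxy =>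
      (h _ Set.ordConnected_Ico _).1 (he x hx y hy hxy))
  · intro Z z hz hmin e he
    exact (h _ (lower_ordConnected Z z) _).2 (hv.lower Z z hz hmin e fun x hx y hy hxy =>
      (h _ Set.ordConnected_Ico _).1 (he x hx y hy hxy))
  · intro I hI hIc c P hsh hc
    exact (h _ hIc _).2 (hv.shuffle I hI hIc c P hsh fun x hx =>
      (h _ (block_ordConnected c hIc x) _).1 (hc x hx))

section

variable {n m : ℕ} {κ : Type*} {c : ∀ w : LabelledOrder E A, Env w n m → w.Pos → κ}
  {I : ∀ w : LabelledOrder E A, Env w n m → Set w.Pos}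
  {x : ∀ w : LabelledOrder E A, Env w n m → w.Pos}

theorem dset_block [Finite κ] (hc : DCol c) (hI : DSet I) (hx : DPos x) :
    DSet fun w γ => block (c w γ) (I w γ) (x w γ) :=
  .of_dfn <| .and (.mem .zero hI.pop) <| .all <| .imp
    (.or (.and (hx.pop.pop.le .zero) (DPos.zero.le DPos.zero.pop))
      (.and (DPos.zero.pop.le .zero) (DPos.zero.le hx.pop.pop)))
    (hc.pop.pop.bind hx.pop.pop fun k => hc.pop.pop.eq .zero k)

theorem dfn_isShuffled [Finite κ] (hc : DCol c) (hI : DSet I) (P : Set κ) :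
    Dfn fun w γ => IsShuffled (c w γ) (I w γ) P := by
  have h₁ : Dfn fun w γ => ∀ x, x ∈ I w γ → c w γ x ∈ P :=
    .all <| .imp (.mem .zero hI.pop) <| hc.pop.bind .zero fun k => .const (k ∈ P)
  have h₂ : Dfn fun w γ => ∀ x, x ∈ I w γ → ∃ y, y ∈ I w γ ∧ y < x ∧
      y ∉ block (c w γ) (I w γ) x :=
    .all <| .imp (.mem .zero hI.pop) <| .ex <| .and (.mem .zero hI.pop.pop) <|
      .and (DPos.zero.lt DPos.zero.pop) <|
        .not <| .mem .zero (dset_block hc.pop.pop hI.pop.pop DPos.zero.pop)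
  have h₃ : Dfn fun w γ => ∀ x, x ∈ I w γ → ∃ y, y ∈ I w γ ∧ x < y ∧
      y ∉ block (c w γ) (I w γ) x :=
    .all <| .imp (.mem .zero hI.pop) <| .ex <| .and (.mem .zero hI.pop.pop) <|
      .and (DPos.zero.pop.lt .zero) <|
        .not <| .mem .zero (dset_block hc.pop.pop hI.pop.pop DPos.zero.pop)
  have h₄ : Dfn fun w γ => ∀ x, x ∈ I w γ → ∀ y, y ∈ I w γ → x < y →
      y ∉ block (c w γ) (I w γ) x → ∀ p, p ∈ P → ∃ z, z ∈ I w γ ∧ x < z ∧ z < y ∧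
        z ∉ block (c w γ) (I w γ) x ∧ y ∉ block (c w γ) (I w γ) z ∧ c w γ z = p :=
    .all <| .imp (.mem .zero hI.pop) <| .all <| .imp (.mem .zero hI.pop.pop) <|
      .imp (DPos.zero.pop.lt .zero) <|
      .imp (.not <| .mem .zero (dset_block hc.pop.pop hI.pop.pop DPos.zero.pop)) <|
      .allFin fun p => .imp (.const _) <| .ex <| .and (.mem .zero hI.pop.pop.pop) <|
      .and (DPos.zero.pop.pop.lt .zero) <| .and (DPos.zero.lt DPos.zero.pop) <|
      .and (.not <| .mem .zero (dset_block hc.pop.pop.pop hI.pop.pop.pop DPos.zero.pop.pop)) <|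
      .and (.not <| .mem DPos.zero.pop (dset_block hc.pop.pop.pop hI.pop.pop.pop .zero)) <|
        hc.pop.pop.pop.eq .zero p
  exact (h₁.and <| h₂.and <| h₃.and h₄).congr fun w γ =>
    ⟨fun h => ⟨h.1, h.2.1, h.2.2.1, h.2.2.2⟩, fun h => ⟨h.1, h.2, h.3, h.4⟩⟩

end

variable [Finite A] [Finite S]

theorem dfn_isClosedRel (a : A → M.Carrier) {Λ : Type*}
    {R : ∀ w : LabelledOrder E A, (w.Pos → Λ) → Set w.Pos → WithOne M.Carrier → Prop}
    (hR : DRel R) {n m : ℕ} {c : ∀ w : LabelledOrder E A, Env w n m → w.Pos → Λ} (hc : DCol c) :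
    Dfn fun w γ => IsClosedRel (fun z => a (w.label z)) (R w (c w γ)) := by
  have h₁ : Dfn fun w γ => ∀ x, R w (c w γ) {x} (a (w.label x)) :=
    .all <| DCol.label.bind (Q := fun b w γ => R w (c w γ.pop) {γ.1 0} (a b)) .zero fun b =>
      hR _ _ _ hc.pop (.singleton .zero)
  have h₂ : Dfn fun w γ => ∀ I J : Set w.Pos, I.Nonempty → J.Nonempty → I.OrdConnected →
      J.OrdConnected → (I ∪ J).OrdConnected → (∀ x, x ∈ I → ∀ y, y ∈ J → x < y) →
      ∀ s t, R w (c w γ) I s → R w (c w γ) J t → R w (c w γ) (I ∪ J) (s * t) :=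
    .allSet <| .allSet <| .imp DSet.zero.popSet.nonempty <| .imp DSet.zero.nonempty <|
      .imp DSet.zero.popSet.ordConnected <| .imp DSet.zero.ordConnected <|
      .imp (DSet.zero.popSet.union .zero).ordConnected <|
      .imp (.all <| .imp (.mem .zero DSet.zero.popSet.pop) <| .all <|
        .imp (.mem .zero DSet.zero.pop.pop) (DPos.zero.pop.lt .zero)) <|
      .allFin fun s => .allFin fun t => .imp (hR _ _ _ hc.popSet.popSet DSet.zero.popSet) <|
      .imp (hR _ _ _ hc.popSet.popSet .zero) <|
        hR _ _ _ hc.popSet.popSet (DSet.zero.popSet.union .zero)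
  have hhom : ∀ e, Dfn (n := n + 1) (m := m + 1) fun (w : LabelledOrder E A) γ =>
      ∀ x, x ∈ γ.2 0 → ∀ y, y ∈ γ.2 0 → x < y → R w (c w γ.pop.popSet) (Set.Ico x y) e := fun e =>
    .all <| .imp (.mem .zero DSet.zero.pop) <| .all <| .imp (.mem .zero DSet.zero.pop.pop) <|
      .imp (DPos.zero.pop.lt .zero) <|
        hR _ _ _ hc.popSet.pop.pop.pop (.Ico DPos.zero.pop .zero)
  have h₃ : Dfn fun w γ => ∀ Z : Set w.Pos, ∀ z, z ∈ Z → (∀ x, x ∈ Z → ∃ y, y ∈ Z ∧ x < y) →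
      ∀ e, (∀ x, x ∈ Z → ∀ y, y ∈ Z → x < y → R w (c w γ) (Set.Ico x y) e) →
      R w (c w γ) (upper Z z) (omega e) :=
    .allSet <| .all <| .imp (.mem .zero DSet.zero.pop) <|
      .imp (.all <| .imp (.mem .zero DSet.zero.pop.pop) <| .ex <|
        .and (.mem .zero DSet.zero.pop.pop.pop) (DPos.zero.pop.lt .zero)) <|
      .allFin fun e => .imp (hhom e) <| hR _ _ _ hc.popSet.pop (.upper DSet.zero.pop .zero)
  have h₄ : Dfn fun w γ => ∀ Z : Set w.Pos, ∀ z, z ∈ Z → (∀ x, x ∈ Z → ∃ y, y ∈ Z ∧ y < x) →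
      ∀ e, (∀ x, x ∈ Z → ∀ y, y ∈ Z → x < y → R w (c w γ) (Set.Ico x y) e) →
      R w (c w γ) (lower Z z) (omegaStar e) :=
    .allSet <| .all <| .imp (.mem .zero DSet.zero.pop) <|
      .imp (.all <| .imp (.mem .zero DSet.zero.pop.pop) <| .ex <|
        .and (.mem .zero DSet.zero.pop.pop.pop) (DPos.zero.lt DPos.zero.pop)) <|
      .allFin fun e => .imp (hhom e) <| hR _ _ _ hc.popSet.pop (.lower DSet.zero.pop .zero)
  have h₅ : Dfn fun w γ => ∀ I : Set w.Pos, I.Nonempty → I.OrdConnected →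
      ∀ (b : w.Pos → M.Carrier × Bool) (P : Set (M.Carrier × Bool)), IsShuffled b I P →
      (∀ x, x ∈ I → R w (c w γ) (block b I x) (b x).1) → R w (c w γ) I (shuffle Prod.fst P) := by
    -- Quantifying over colourings needs a nonempty set of colours; without colours the condition is
    -- vacuous, since `I` has a point to colour.
    by_cases hne : Nonempty M.Carrier
    swap
    · refine (Dfn.const True).congr fun w γ => ⟨fun _ I hI _ b => ?_, fun _ => trivial⟩
      obtain ⟨x, -⟩ := hI
      exact (hne ⟨(b x).1⟩).elim
    refine .allSet <| .imp DSet.zero.nonempty <| .imp DSet.zero.ordConnected <|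
      .allCol fun d b hd hb => .allFin fun P => ?_
    have hI := DSet.zero.comp hd
    have hc' := hc.popSet.comp hd
    refine .imp (dfn_isShuffled hb hI P) <| .imp ?_ (hR _ _ _ hc' hI)
    refine .all <| .imp (.mem .zero hI.pop) <| hb.pop.bind
      (Q := fun k w γ => R w (c w (d w γ.pop).popSet) (block (b w γ.pop) ((d w γ.pop).2 0) (γ.1 0))
        (k.1 : WithOne M.Carrier)) .zero fun k => ?_
    exact hR _ _ _ hc'.pop (dset_block hb.pop hI.pop .zero)
  exact (h₁.and <| h₂.and <| h₃.and <| h₄.and h₅).congr fun w γ =>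
    ⟨fun h => ⟨h.1, h.2.1, h.2.2.1, h.2.2.2.1, h.2.2.2.2⟩,
      fun h => ⟨h.1, h.2, h.3, h.4, h.5⟩⟩

/-- The value of nonempty words is definable. -/
theorem dfn_value (a : A → M.Carrier) (s : WithOne M.Carrier) :
    Dfn (n := 0) (m := 0) fun (w : LabelledOrder E A) _ =>
      Nonempty w.Pos ∧ value (fun z => a (w.label z)) Set.univ = s := by
  obtain ⟨Λ, _, _, R, hR, -, hcorrect⟩ := evalDefinable (E := E) a 0
  -- The guessed `c` need not be the intended colouring: closure puts the true value into `R`, and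
  -- the last condition excludes every value but `s`. Closure says nothing about the empty interval,
  -- so a position is required.
  have key : Dfn (n := 0) (m := 0) fun (w : LabelledOrder E A) _ =>
      (∃ _ : w.Pos, True) ∧ ∃ c : w.Pos → Λ, IsClosedRel (fun z => a (w.label z)) (R w c) ∧
        (∀ t, R w c Set.univ t → t = s) := by
    refine .and (.ex (.const _)) (.exCol fun d c hd hc => .and (dfn_isClosedRel a hR hc) ?_)
    exact .allFin fun t => .imp (hR _ _ _ hc .univ) (.const _)
  refine key.congr fun w _ => ⟨?_, ?_⟩
  · rintro ⟨⟨x, -⟩, c, hcl, hs⟩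
    exact ⟨⟨x⟩, hs _ (hcl.ok Set.ordConnected_univ ⟨x, trivial⟩)⟩
  · rintro ⟨⟨x⟩, rfl⟩
    obtain ⟨c, hc⟩ := hcorrect w Set.univ Set.ordConnected_univ (fun _ _ _ _ _ => Nat.zero_le _)
    exact ⟨⟨x, trivial⟩, c, isClosedRel_of_iff fun I => hc I (Set.subset_univ I),
      fun t ht => ((hc _ subset_rfl Set.ordConnected_univ t).1 ht).symm⟩

end

end CircSemigroup

/-! ### Recognisable languages are definable -/

section

variable {E : Prop} {A : Type u} {S : Type v}

theorem Word.flatten_map_unit (w : LabelledOrder E A) :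
    Word.flatten (Word.map Word.unit (Word.mk w)) = Word.mk w := by
  refine (Word.flatten_mk (w.map LabelledOrder.single)).trans
    (Quotient.sound ⟨LabelledOrder.Iso.symm ?_⟩)
  let F : w.Pos → (w.map (LabelledOrder.single (E := E))).lexProd.Pos := fun x => toLex ⟨x, ()⟩
  have hmono : StrictMono F := fun x y h => Sigma.Lex.lt_def.2 (Or.inl h)
  exact ⟨hmono.orderIsoOfSurjective _ (fun p => ⟨(ofLex p).1, rfl⟩), fun _ => rfl⟩

/-- A word is the free product of its letters, so its image is the product of their images. -/
theorem IsHom.apply_mk {M : CircSemigroup E S} {h : Word E A → S} (hh : IsHom (free E A) M h)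
    (w : LabelledOrder E A) :
    h (Word.mk w) = M.mul (Word.mk (w.map fun b => h (Word.unit b))) := by
  conv_lhs => rw [← Word.flatten_map_unit w]
  exact hh (Word.map Word.unit (Word.mk w))

theorem IsHom.value_univ {M : CircSemigroup E S} {h : Word E A → S} (hh : IsHom (free E A) M h)
    (w : LabelledOrder E A) [Nonempty w.Pos] :
    CircSemigroup.value (M := M) (fun z => h (Word.unit (w.label z))) Set.univ
      = (WithOne.coe (h (Word.mk w)) : WithOne M.Carrier) :=
  (CircSemigroup.value_univ (M := M) fun z => h (Word.unit (w.label z))).trans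
    (congrArg WithOne.coe (hh.apply_mk w).symm)

end

end CircWord

theorem mainTheorem5 (E : Prop) {A : Type*} [Finite A] {S : Type*} [Finite S]
    (M : CircWord.CircSemigroup E S) (L : Set (CircWord.Word E A))
    (hL : CircWord.RecognisedBy L M) : CircWord.MSODefinable L := by
  open CircWord in
  obtain ⟨h, hh, hsat⟩ := hL
  let a : A → M.Carrier := fun b => h (Word.unit b)
  -- There is at most one empty word, so its membership in `L` is a fixed truth value.
  have hempty : Dfn (n := 0) (m := 0) fun (w : LabelledOrder E A) _ =>
      (¬ ∃ _ : w.Pos, True) ∧ ∃ w₀ : LabelledOrder E A, IsEmpty w₀.Pos ∧ Word.mk w₀ ∈ L :=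
    .and (.not (.ex (.const _))) (.const _)
  have hnonempty : Dfn (n := 0) (m := 0) fun (w : LabelledOrder E A) _ =>
      ∃ s : M.Carrier, (∃ u ∈ L, h u = s) ∧ Nonempty w.Pos ∧
        CircSemigroup.value (fun z => a (w.label z)) Set.univ = s :=
    .exFin fun s => .and (.const _) (CircSemigroup.dfn_value a s)
  obtain ⟨φ, hφ⟩ := hempty.or hnonempty
  refine ⟨φ, fun w => Iff.trans ?_ (hφ w (Fin.elim0, Fin.elim0)).symm⟩
  constructor
  · intro hw
    by_cases hne : Nonempty w.Pos
    · exact Or.inr ⟨h (Word.mk w), ⟨_, hw, rfl⟩, hne, hh.value_univ w⟩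
    · exact Or.inl ⟨fun ⟨x, _⟩ => hne ⟨x⟩, w, not_nonempty_iff.1 hne, hw⟩
  · rintro (⟨hne, w₀, hw₀, hw₀L⟩ | ⟨s, ⟨u, hu, rfl⟩, hne, hs⟩)
    · have : IsEmpty w.Pos := ⟨fun x => hne ⟨x, trivial⟩⟩
      have heq : Word.mk w = Word.mk w₀ :=
        Quotient.sound ⟨⟨⟨Equiv.equivOfIsEmpty _ _, fun {x} => isEmptyElim x⟩,
          fun x => isEmptyElim x⟩⟩
      rwa [heq]
    · exact (hsat _ _ (WithOne.coe_injective ((hh.value_univ w).symm.trans hs))).2 hu
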